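/- Write $\tilde I=\begin{bmatrix}0&-1\\1&0\end{bmatrix}$, $\tilde J=\begin{bmatrix}1&0\\0&-1\end{bmatrix}$, $\tilde K=\begin{bmatrix}0&1\\1&0\end{bmatrix}$, and let $\tilde{\mathbb K}=\{-\sin\beta\,\tilde J+\cos\beta\,\tilde K:\beta\in[0,2\pi)\}$ be the set of conjugates of $\tilde K$ by orthogonal matrices. Let $D(0,r)$ and $\bar D(0,r)$ be the open and closed disks of radius $r$ around $0$ in $\mathbb C$. For $A=\begin{bmatrix}a&b\\c&d\end{bmatrix}\in M_2(\mathbb R)$ let the chiral disk $CD(A)\subset\mathbb C$ be the closed disk with center $\frac{a+d}2+\frac{c-b}2 i$ and radius $\sqrt{(\frac{a-d}2)^2+(\frac{b+c}2)^2}$. For a continuous $h:[a,b]\to M_2(\mathbb R)$ let $$\mathrm{Lexp}(h\,d\theta|_{[a,b]})=\sum_{n\ge0}\int_{a\le s_1\le\dots\le s_n\le b}h(s_n)\cdots h(s_1)\,ds_1\cdots ds_n$$ be its time-ordered exponential (later factors on the left). For $p_1,p_2\ge0$, $t\in\mathbb R$, $\tilde F\in\tilde{\mathbb K}$ put $$NW(p_1,p_2,t,\tilde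 F)=e^{p_1\cos t}\Bigl(\exp((p_1+p_2)\sin t\,\tilde I)\Bigl(\cosh(p_2\cos t)\,\mathrm{Id}-\tfrac{\sinh(p_2\cos t)}{\cos t}\sin t\,\tilde I\Bigr)+\tfrac{\sinh(p_2\cos t)}{\cos t}\tilde F\Bigr),$$ where $\frac{\sinh(p_2\cos t)}{\cos t}$ means $p_2$ if $\cos t=0$. **Theorem.** Let $A\in M_2(\mathbb R)$ satisfy $CD(A)\subset\exp D(0,\pi)$. Let $p$ be the smallest real number such that $CD(A)\subset\exp\bar D(0,p)$, and suppose that $CD(A)$ touches $\exp\partial\bar D(0,p)$ at $e^{p(\cos t+i\sin t)}$, i.e. contains this point. Then there are $p_1,p_2\ge0$ with $p=p_1+p_2$ and $\tilde F\in\tilde{\mathbb K}$ such that $$\begin{aligned}A&=NW(p_1,p_2,t,\tilde F)\\&=\mathrm{Lexp}\bigl(p_1\exp(t\tilde I)+p_2\exp(2p\theta\sin t\,\tilde I)\tilde F\;d\theta|_{[-1/2,1/2]}\bigr)\\&=\mathrm{Lexp}\bigl(\exp(t\tilde I)\,d\theta|_{[0,p_1]}\bigr)\,\mathrm{Lexp}\bigl(\exp((2\theta-p_1-p_2)\sin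 t\,\tilde I)\tilde F\,d\theta|_{[0,p_2]}\bigr)\\&=\mathrm{Lexp}\bigl(\exp((2\theta+p_1-p_2)\sin t\,\tilde I)\tilde F\,d\theta|_{[0,p_2]}\bigr)\,\mathrm{Lexp}\bigl(\exp(t\tilde I)\,d\theta|_{[0,p_1]}\bigr).\end{aligned}$$ Moreover, for any $p_1,p_2\ge0$ with $p=p_1+p_2$ and any $\tilde F\in\tilde{\mathbb K}$ with $A=NW(p_1,p_2,t,\tilde F)$: 1. $p_1=p_2=0$ if and only if $A=\mathrm{Id}$. 2. $p_1>0$, $p_2=0$ if and only if $A\ne\mathrm{Id}$ and $CD(A)$ is a single point; in this case $A=NW(p_1,p_2,t,\tilde F')$ for every $\tilde F'\in\tilde{\mathbb K}$. 3. $p_1=0$, $p_2>0$ if and only if $A\ne\mathrm{Id}$ and $CD(A)$ is maximal under inclusion among the closed disks (points included) contained in $\exp\bar D(0,p)$. In this case also $A=NW(p_1,p_2,\pi-t,\tilde F)$, and whenever $A=NW(p_1',p_2',t',\tilde F')$ with $p_1',p_2'\ge0$, $p_1'+p_2'<\pi$, $\tilde F'\in\tilde{\mathbb K}$, one has $p_1'=p_1$,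 $p_2'=p_2$, $\tilde F'=\tilde F$, and $t'\equiv t$ or $t'\equiv\pi-t$ mod $2\pi$. 4. If $p_1,p_2>0$, then whenever $A=NW(p_1',p_2',t',\tilde F')$ with $p_1',p_2'\ge0$, $p_1'+p_2'<\pi$, $\tilde F'\in\tilde{\mathbb K}$, one has $p_1'=p_1$, $p_2'=p_2$, $\tilde F'=\tilde F$ and $t'\equiv t$ mod $2\pi$. -/

import Mathlib

/-!
The chiral disk of `normalForm p₁ p₂ t F` touches the boundary of the image of the disk of radius
`p = p₁ + p₂` under `exp` from inside at `exp (p (cos t + i sin t))`, and for fixed `p` and `t` its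
radius grows strictly with `p₂`. It stays inside the image: each of its points `ζ` lies on the
boundary circle of a smaller disk of the same family, with parameters `p - q` and `q`. Fixing
`p₁ = p - q` and letting `p₂` grow from `0` to `q` leads from `exp ((p - q) (cos t + i sin t))` to
`ζ` along a curve whose logarithmic derivative has norm one, so `ζ` has a logarithm of norm at most
`p`; the equality case of the triangle inequality determines the points of contact.

Conversely, a disk in the image touching the boundary at that point has its center on the inner
normal. Its radius is at most that of the disk for `p₁ = 0`, because the latter has a second
contact point at `π - t`, or, when the two contact points coincide, because it osculates the
boundary. So every touching disk occurs for exactly one `p₂`. The direction of the second component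
of `A` in the decomposition `v ↦ z v + w v̄` is the remaining parameter `F`.

The time-ordered exponentials solve linear differential equations that become autonomous in a
rotating frame, where they are ordinary matrix exponentials.
-/

noncomputable section

/-- The chiral disk of a real `2 × 2` matrix `[a, b; c, d]`: the closed disk in `ℂ` with center
`(a + d) / 2 + i (c - b) / 2` and radius `√(((a - d) / 2)² + ((b + c) / 2)²)`. -/
def chiralDisk (A : Matrix (Fin 2) (Fin 2) ℝ) : Set ℂ :=
  Metric.closedBall (⟨(A 0 0 + A 1 1) / 2, (A 1 0 - A 0 1) / 2⟩ : ℂ)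
    (Real.sqrt (((A 0 0 - A 1 1) / 2) ^ 2 + ((A 0 1 + A 1 0) / 2) ^ 2))

/-- The skew-quaternionic unit `Ĩ`. -/
def matI : Matrix (Fin 2) (Fin 2) ℝ := !![0, -1; 1, 0]

/-- The skew-quaternionic unit `J̃`. -/
def matJ : Matrix (Fin 2) (Fin 2) ℝ := !![1, 0; 0, -1]

/-- The skew-quaternionic unit `K̃`. -/
def matK : Matrix (Fin 2) (Fin 2) ℝ := !![0, 1; 1, 0]

/-- The set of the conjugates of `K̃` by orthogonal matrices. -/
def conjK : Set (Matrix (Fin 2) (Fin 2) ℝ) :=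
  {F | ∃ β ∈ Set.Ico (0 : ℝ) (2 * Real.pi), F = -Real.sin β • matJ + Real.cos β • matK}

/-- `exp (α Ĩ)`, with the matrix exponential. -/
def expI (α : ℝ) : Matrix (Fin 2) (Fin 2) ℝ := NormedSpace.exp (α • matI)

/-- `sinh (q x) / x`, understood as `q` for `x = 0`. -/
def sinhQuot (q x : ℝ) : ℝ := if x = 0 then q else Real.sinh (q * x) / x

/-- The arithmetic normal form. -/
def normalForm (p₁ p₂ t : ℝ) (F : Matrix (Fin 2) (Fin 2) ℝ) : Matrix (Fin 2) (Fin 2) ℝ :=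
  Real.exp (p₁ * Real.cos t) •
    (expI ((p₁ + p₂) * Real.sin t) *
        (Real.cosh (p₂ * Real.cos t) • (1 : Matrix (Fin 2) (Fin 2) ℝ)
          - (sinhQuot p₂ (Real.cos t) * Real.sin t) • matI)
      + sinhQuot p₂ (Real.cos t) • F)

/-- The `n`-th ordered iterated integral
`∫_{a ≤ s₁ ≤ ⋯ ≤ sₙ ≤ x} h(sₙ) ⋯ h(s₁) ds₁ ⋯ dsₙ` (integrals are taken entrywise). -/
def orderedIntegral (h : ℝ → Matrix (Fin 2) (Fin 2) ℝ) (a : ℝ) :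
    ℕ → ℝ → Matrix (Fin 2) (Fin 2) ℝ
  | 0, _ => 1
  | n + 1, x => Matrix.of fun i j => ∫ s in a..x, (h s * orderedIntegral h a n s) i j

/-- The left time-ordered exponential of the matrix valued measure `h(θ) dθ` on `[a, b]`:
the sum of all ordered iterated integrals, where later factors stand to the left. -/
def leftExp (h : ℝ → Matrix (Fin 2) (Fin 2) ℝ) (a b : ℝ) : Matrix (Fin 2) (Fin 2) ℝ :=
  ∑' n : ℕ, orderedIntegral h a n b

/-- `D` is a maximal element among the closed disks (points included) contained in `S`. -/
def IsMaximalDisk (S D : Set ℂ) : Prop :=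
  Maximal (fun D' : Set ℂ => (∃ (z : ℂ) (r : ℝ), 0 ≤ r ∧ D' = Metric.closedBall z r) ∧ D' ⊆ S) D

end

section BanachAlgebra

open NormedSpace (exp)

variable {𝔸 : Type*} [NormedRing 𝔸] [NormedAlgebra ℝ 𝔸]

/-- The `n`-th term `∫_{a ≤ s₁ ≤ ⋯ ≤ sₙ ≤ x} h(sₙ) ⋯ h(s₁) ds₁ ⋯ dsₙ` of the Dyson series of `h`,
the iterated Bochner integral that `orderedIntegral` computes entrywise. -/
noncomputable def dysonTerm (h : ℝ → 𝔸) (a : ℝ) : ℕ → ℝ → 𝔸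
  | 0, _ => 1
  | n + 1, x => ∫ s in a..x, h s * dysonTerm h a n s

theorem norm_le_of_iterated_integral {h : ℝ → 𝔸} {E : ℕ → ℝ → 𝔸} {a b M K : ℝ}
    (hM : ∀ θ ∈ Set.Icc a b, ‖h θ‖ ≤ M) (hK : ∀ θ ∈ Set.Icc a b, ‖E 0 θ‖ ≤ K)
    (hE : ∀ n x, E (n + 1) x = ∫ s in a..x, h s * E n s) (n : ℕ) :
    ∀ x ∈ Set.Icc a b, ‖E n x‖ ≤ K * ((M * (x - a)) ^ n / n.factorial) := by
  induction n with
  | zero => simpa using hK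
  | succ n ih =>
    intro x hx
    have hderiv (s : ℝ) : HasDerivAt (fun s => K * ((M * (s - a)) ^ (n + 1) / (n + 1).factorial))
        (M * (K * ((M * (s - a)) ^ n / n.factorial))) s := by
      convert! (((((hasDerivAt_id s).sub_const a).const_mul M).pow (n + 1)).div_const
        ((n + 1).factorial : ℝ)).const_mul K using 1
      rw [Nat.factorial_succ]
      push_cast
      simp only [id_eq]
      field_simp
    have hcont : Continuous fun s : ℝ => M * (K * ((M * (s - a)) ^ n / n.factorial)) := by
      fun_prop
    have hval := intervalIntegral.integral_eq_sub_of_hasDerivAt (a := a) (b := x)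
      (fun s _ => hderiv s) (hcont.intervalIntegrable a x)
    rw [sub_self, mul_zero, zero_pow n.succ_ne_zero, zero_div, mul_zero, sub_zero] at hval
    rw [hE, ← hval]
    refine intervalIntegral.norm_integral_le_of_norm_le hx.1
      (Filter.Eventually.of_forall fun s hs => ?_) (hcont.intervalIntegrable a x)
    have hs' : s ∈ Set.Icc a b := ⟨hs.1.le, hs.2.trans hx.2⟩
    exact (norm_mul_le _ _).trans
      (mul_le_mul (hM s hs') (ih s hs') (norm_nonneg _) ((norm_nonneg _).trans (hM s hs')))

theorem continuous_dysonTerm {h : ℝ → 𝔸} (hh : Continuous h) (a : ℝ) (n : ℕ) :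
    Continuous (dysonTerm h a n) := by
  induction n with
  | zero => exact continuous_const
  | succ n ih =>
    exact intervalIntegral.continuous_primitive (fun _ _ => (hh.mul ih).intervalIntegrable _ _) a

variable [CompleteSpace 𝔸]

theorem exp_smul_mul_exp_smul (r s : ℝ) (X : 𝔸) :
    exp (r • X) * exp (s • X) = exp ((r + s) • X) := by
  let _ : NormedAlgebra ℚ 𝔸 := .restrictScalars ℚ ℝ 𝔸
  rw [add_smul, NormedSpace.exp_add_of_commute (((Commute.refl X).smul_left r).smul_right s)]

theorem exp_smul_eq_of_hasDerivAt {X : 𝔸} {U : ℝ → 𝔸} (hU : ∀ θ, HasDerivAt U (X * U θ) θ)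
    (h0 : U 0 = 1) (θ : ℝ) : exp (θ • X) = U θ := by
  have hderiv (s : ℝ) : HasDerivAt (fun s => exp (s • -X) * U s) 0 s := by
    convert! (hasDerivAt_exp_smul_const (-X) s).mul (hU s) using 1
    noncomm_ring
  have hconst : exp (θ • -X) * U θ = 1 := by
    simpa [h0] using is_const_of_deriv_eq_zero (fun s => (hderiv s).differentiableAt)
      (fun s => (hderiv s).deriv) θ 0
  rw [← mul_one (exp (θ • X)), ← hconst, smul_neg, ← neg_smul, ← mul_assoc,
    exp_smul_mul_exp_smul]
  simp

theorem exp_smul_of_mul_self_eq_neg_one {X : 𝔸} (hX : X * X = -1) (α : ℝ) :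
    exp (α • X) = Real.cos α • (1 : 𝔸) + Real.sin α • X := by
  refine exp_smul_eq_of_hasDerivAt (U := fun α => Real.cos α • (1 : 𝔸) + Real.sin α • X)
    (fun θ => ?_) (by simp) α
  convert! ((Real.hasDerivAt_cos θ).smul_const (1 : 𝔸)).add
    ((Real.hasDerivAt_sin θ).smul_const X) using 1
  rw [mul_add, mul_smul_comm, mul_smul_comm, hX, mul_one, smul_neg, neg_smul, add_comm]

theorem mul_sinhQuot (q x : ℝ) : x * sinhQuot q x = Real.sinh (q * x) := by
  unfold sinhQuot
  split_ifs with h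
  · simp [h]
  · field_simp

theorem hasDerivAt_sinhQuot (x q : ℝ) :
    HasDerivAt (fun q => sinhQuot q x) (Real.cosh (q * x)) q := by
  unfold sinhQuot
  split_ifs with h
  · simpa [h] using hasDerivAt_id' q
  · convert! ((hasDerivAt_mul_const x).sinh.div_const x) using 1
    field_simp

theorem hasDerivAt_cosh_mul (x q : ℝ) :
    HasDerivAt (fun q => Real.cosh (q * x)) (x ^ 2 * sinhQuot q x) q := by
  convert! (hasDerivAt_mul_const x).cosh using 1
  linear_combination x * mul_sinhQuot q x

theorem sinhQuot_zero_left (x : ℝ) : sinhQuot 0 x = 0 := by simp [sinhQuot]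

theorem exp_smul_of_mul_self_eq_smul_one {N : 𝔸} {c : ℝ} (hN : N * N = c ^ 2 • (1 : 𝔸)) (q : ℝ) :
    exp (q • N) = Real.cosh (q * c) • (1 : 𝔸) + sinhQuot q c • N := by
  refine exp_smul_eq_of_hasDerivAt
    (U := fun q => Real.cosh (q * c) • (1 : 𝔸) + sinhQuot q c • N)
    (fun θ => ?_) (by simp [sinhQuot_zero_left]) q
  convert! ((hasDerivAt_cosh_mul c θ).smul_const (1 : 𝔸)).add
    ((hasDerivAt_sinhQuot c θ).smul_const N) using 1
  rw [mul_add, mul_smul_comm, mul_smul_comm, hN, mul_one, smul_smul, mul_comm (c ^ 2), add_comm]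

theorem sub_sum_dysonTerm_eq_integral {h U : ℝ → 𝔸} {a : ℝ} (hh : Continuous h)
    (hU : ∀ θ, HasDerivAt U (h θ * U θ) θ) (ha : U a = 1) (n : ℕ) (x : ℝ) :
    U x - ∑ k ∈ Finset.range (n + 1), dysonTerm h a k x =
      ∫ s in a..x, h s * (U s - ∑ k ∈ Finset.range n, dysonTerm h a k s) := by
  have hhU : Continuous fun s => h s * U s :=
    hh.mul (continuous_iff_continuousAt.2 fun θ => (hU θ).continuousAt)
  have hterm (k : ℕ) : Continuous fun s => h s * dysonTerm h a k s :=
    hh.mul (continuous_dysonTerm hh a k)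
  have hftc : ∫ s in a..x, h s * U s = U x - 1 := ha ▸
    intervalIntegral.integral_eq_sub_of_hasDerivAt (fun s _ => hU s)
      (hhU.intervalIntegrable a x)
  simp only [mul_sub, Finset.mul_sum]
  rw [intervalIntegral.integral_sub (hhU.intervalIntegrable a x)
      ((continuous_finsetSum _ fun k _ => hterm k).intervalIntegrable a x),
    intervalIntegral.integral_finsetSum fun k _ => (hterm k).intervalIntegrable a x, hftc,
    Finset.sum_range_succ']
  simp only [dysonTerm]
  abel

theorem hasSum_dysonTerm {h U : ℝ → 𝔸} {a b : ℝ} (hab : a ≤ b) (hh : Continuous h)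
    (hU : ∀ θ, HasDerivAt U (h θ * U θ) θ) (ha : U a = 1) :
    HasSum (fun n => dysonTerm h a n b) (U b) := by
  obtain ⟨M, hM⟩ := isCompact_Icc.exists_bound_of_continuousOn (s := Set.Icc a b) hh.continuousOn
  obtain ⟨K, hK⟩ := isCompact_Icc.exists_bound_of_continuousOn (s := Set.Icc a b) (f := U)
    (fun θ _ => (hU θ).continuousAt.continuousWithinAt)
  have hb : b ∈ Set.Icc a b := ⟨hab, le_rfl⟩
  have hfac := Real.summable_pow_div_factorial (M * (b - a))
  have hsum : Summable fun n => dysonTerm h a n b :=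
    Summable.of_norm_bounded (hfac.mul_left ‖(1 : 𝔸)‖) fun n =>
      norm_le_of_iterated_integral (E := dysonTerm h a) hM (fun _ _ => le_rfl)
        (fun _ _ => rfl) n b hb
  have hrem : Filter.Tendsto (fun n => U b - ∑ k ∈ Finset.range n, dysonTerm h a k b)
      Filter.atTop (nhds 0) :=
    squeeze_zero_norm (fun n => norm_le_of_iterated_integral
      (E := fun n x => U x - ∑ k ∈ Finset.range n, dysonTerm h a k x) hM (by simpa using hK)
      (sub_sum_dysonTerm_eq_integral hh hU ha) n b hb)
      (by simpa using hfac.tendsto_atTop_zero.const_mul K)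
  rw [hsum.hasSum_iff_tendsto_nat]
  simpa using (tendsto_const_nhds (x := U b)).sub hrem

theorem hasDerivAt_rotating_solution (X B : 𝔸) (a θ₀ θ : ℝ) :
    HasDerivAt
      (fun θ => exp ((θ - θ₀) • X) * exp ((θ - a) • (B - X)) * exp (-(a - θ₀) • X))
      (exp ((θ - θ₀) • X) * B * exp (-(θ - θ₀) • X) *
        (exp ((θ - θ₀) • X) * exp ((θ - a) • (B - X)) * exp (-(a - θ₀) • X))) θ := by
  have hX : HasDerivAt (fun θ => exp ((θ - θ₀) • X)) (exp ((θ - θ₀) • X) * X) θ :=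
    (hasDerivAt_exp_smul_const X (θ - θ₀)).comp_sub_const θ θ₀
  have hBX : HasDerivAt (fun θ => exp ((θ - a) • (B - X)))
      ((B - X) * exp ((θ - a) • (B - X))) θ :=
    (hasDerivAt_exp_smul_const' (B - X) (θ - a)).comp_sub_const θ a
  have hinv : exp (-(θ - θ₀) • X) * exp ((θ - θ₀) • X) = 1 := by
    rw [exp_smul_mul_exp_smul]
    simp
  convert! (hX.mul hBX).mul_const (exp (-(a - θ₀) • X)) using 1
  simp only [mul_assoc]
  rw [← mul_assoc (exp (-(θ - θ₀) • X)), hinv]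
  noncomm_ring

end BanachAlgebra

section MatrixNorm

open scoped Matrix.Norms.Operator
open NormedSpace (exp)

theorem matrix_intervalIntegral_apply {m n : Type*} [Fintype m] [Fintype n]
    {f : ℝ → Matrix m n ℝ} (hf : Continuous f) (a b : ℝ) (i : m) (j : n) :
    (∫ s in a..b, f s) i j = ∫ s in a..b, f s i j :=
  ((Matrix.entryLinearMap ℝ ℝ i j).toContinuousLinearMap.intervalIntegral_comp_comm
    (hf.intervalIntegrable a b)).symm

variable {h : ℝ → Matrix (Fin 2) (Fin 2) ℝ} {a b : ℝ}

theorem orderedIntegral_eq_dysonTerm (hh : Continuous h) (a : ℝ) (n : ℕ) :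
    orderedIntegral h a n = dysonTerm h a n := by
  induction n with
  | zero => rfl
  | succ n ih =>
    ext x i j
    rw [orderedIntegral, dysonTerm, ih]
    exact (matrix_intervalIntegral_apply (f := fun s => h s * dysonTerm h a n s)
      (hh.mul (continuous_dysonTerm hh a n)) a x i j).symm

theorem leftExp_eq_of_hasDerivAt {U : ℝ → Matrix (Fin 2) (Fin 2) ℝ} (hab : a ≤ b)
    (hh : Continuous h) (hU : ∀ θ, HasDerivAt U (h θ * U θ) θ) (ha : U a = 1) :
    leftExp h a b = U b := by
  simp only [leftExp, orderedIntegral_eq_dysonTerm hh]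
  exact (hasSum_dysonTerm hab hh hU ha).tsum_eq

theorem leftExp_exp_smul_conj (hab : a ≤ b) (θ₀ : ℝ) (X B : Matrix (Fin 2) (Fin 2) ℝ) :
    leftExp (fun θ => exp ((θ - θ₀) • X) * B * exp (-(θ - θ₀) • X)) a b =
      exp ((b - θ₀) • X) * exp ((b - a) • (B - X)) * exp (-(a - θ₀) • X) := by
  have hexp : Continuous fun θ : ℝ => exp (θ • X) :=
    continuous_iff_continuousAt.2 fun θ => (hasDerivAt_exp_smul_const X θ).continuousAt
  refine leftExp_eq_of_hasDerivAt hab ?_ (hasDerivAt_rotating_solution X B a θ₀) ?_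
  · exact ((hexp.comp (continuous_sub_right θ₀)).mul continuous_const).mul
      (hexp.comp (continuous_sub_right θ₀).neg)
  · rw [sub_self, zero_smul, NormedSpace.exp_zero, mul_one, exp_smul_mul_exp_smul, add_neg_cancel,
      zero_smul, NormedSpace.exp_zero]

theorem exp_smul_one_add {n : Type*} [Fintype n] [DecidableEq n] (r : ℝ) (N : Matrix n n ℝ) :
    exp (r • (1 : Matrix n n ℝ) + N) = Real.exp r • exp N := by
  have hscalar : exp (r • (1 : Matrix n n ℝ)) = Real.exp r • (1 : Matrix n n ℝ) := by
    rw [Matrix.smul_one_eq_diagonal, Matrix.exp_diagonal, Matrix.smul_one_eq_diagonal,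
      Real.exp_eq_exp_ℝ, Pi.exp_def]
  rw [Matrix.exp_add_of_commute _ _ ((Commute.one_left N).smul_left r), hscalar, smul_one_mul]

theorem matI_mul_matI : matI * matI = -1 := by
  ext i j
  fin_cases i <;> fin_cases j <;> simp [matI]

theorem expI_eq (α : ℝ) :
    expI α = Real.cos α • (1 : Matrix (Fin 2) (Fin 2) ℝ) + Real.sin α • matI :=
  exp_smul_of_mul_self_eq_neg_one matI_mul_matI α

theorem expI_zero : expI 0 = 1 := by simp [expI_eq]

theorem expI_mul_expI (α β : ℝ) : expI α * expI β = expI (α + β) :=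
  exp_smul_mul_exp_smul α β matI

theorem matI_mul_expI (α : ℝ) : matI * expI α = expI α * matI := by
  simp only [expI_eq, mul_add, add_mul, mul_smul_comm, smul_mul_assoc, mul_one, one_mul]

theorem mul_self_of_mem_conjK {F : Matrix (Fin 2) (Fin 2) ℝ} (hF : F ∈ conjK) : F * F = 1 := by
  obtain ⟨β, -, rfl⟩ := hF
  ext i j
  fin_cases i <;> fin_cases j <;> simp [matJ, matK, ← sq, Matrix.mul_apply] <;> ring

theorem mul_matI_of_mem_conjK {F : Matrix (Fin 2) (Fin 2) ℝ} (hF : F ∈ conjK) :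
    F * matI = -(matI * F) := by
  obtain ⟨β, -, rfl⟩ := hF
  ext i j
  fin_cases i <;> fin_cases j <;> simp [matI, matJ, matK]

variable {F : Matrix (Fin 2) (Fin 2) ℝ}

theorem mul_expI_of_mem_conjK (hF : F ∈ conjK) (α : ℝ) : F * expI α = expI (-α) * F := by
  simp only [expI_eq, mul_add, add_mul, mul_smul_comm, smul_mul_assoc, mul_one, one_mul,
    mul_matI_of_mem_conjK hF, Real.cos_neg, Real.sin_neg, smul_neg, neg_smul, neg_mul]

theorem expI_mul_mul_expI_neg (hF : F ∈ conjK) (α : ℝ) :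
    expI α * F * expI (-α) = expI (2 * α) * F := by
  rw [mul_assoc, mul_expI_of_mem_conjK hF, ← mul_assoc, expI_mul_expI, neg_neg, two_mul]

theorem exp_smul_sub_sin_smul_matI (hF : F ∈ conjK) (q t : ℝ) :
    exp (q • (F - Real.sin t • matI)) =
      Real.cosh (q * Real.cos t) • (1 : Matrix (Fin 2) (Fin 2) ℝ) +
        sinhQuot q (Real.cos t) • (F - Real.sin t • matI) := by
  refine exp_smul_of_mul_self_eq_smul_one ?_ q
  rw [sub_mul, mul_sub, mul_sub, mul_self_of_mem_conjK hF, mul_smul_comm, smul_mul_assoc,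
    smul_mul_smul_comm, matI_mul_matI, mul_matI_of_mem_conjK hF, Real.cos_sq']
  module

theorem expI_mul_exp_mul_expI (hF : F ∈ conjK) (q t α β : ℝ) :
    expI α * exp (q • (F - Real.sin t • matI)) * expI β =
      expI (α + β) * (Real.cosh (q * Real.cos t) • (1 : Matrix (Fin 2) (Fin 2) ℝ) -
        (sinhQuot q (Real.cos t) * Real.sin t) • matI) +
      sinhQuot q (Real.cos t) • (expI (α - β) * F) := by
  rw [exp_smul_sub_sin_smul_matI hF, mul_assoc, add_mul, smul_mul_assoc, one_mul, smul_mul_assoc,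
    sub_mul, smul_mul_assoc, mul_expI_of_mem_conjK hF, matI_mul_expI, sub_eq_add_neg α,
    ← expI_mul_expI, ← expI_mul_expI]
  simp only [mul_add, mul_sub, mul_smul_comm, mul_one, mul_assoc]
  module

theorem normalForm_eq_expI_mul_exp_mul_expI (hF : F ∈ conjK) (p₁ p₂ t : ℝ) :
    normalForm p₁ p₂ t F = Real.exp (p₁ * Real.cos t) •
      (expI ((p₁ + p₂) * Real.sin t / 2) * exp (p₂ • (F - Real.sin t • matI)) *
        expI ((p₁ + p₂) * Real.sin t / 2)) := by
  rw [expI_mul_exp_mul_expI hF, add_halves, sub_self, expI_zero, one_mul, normalForm]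

theorem leftExp_const (hab : a ≤ b) (B : Matrix (Fin 2) (Fin 2) ℝ) :
    leftExp (fun _ => B) a b = exp ((b - a) • B) := by
  simpa using leftExp_exp_smul_conj hab 0 0 B

theorem leftExp_expI_conj (hab : a ≤ b) (ω θ₀ : ℝ) (B : Matrix (Fin 2) (Fin 2) ℝ) :
    leftExp (fun θ => expI ((θ - θ₀) * ω) * B * expI (-((θ - θ₀) * ω))) a b =
      expI ((b - θ₀) * ω) * exp ((b - a) • (B - ω • matI)) * expI (-((a - θ₀) * ω)) := by
  simpa only [expI, smul_smul, neg_mul] using leftExp_exp_smul_conj hab θ₀ (ω • matI) B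

theorem normalForm_eq_leftExp (hF : F ∈ conjK) (p₁ p₂ t : ℝ) :
    normalForm p₁ p₂ t F = leftExp (fun θ => p₁ • expI t +
      p₂ • (expI (2 * (p₁ + p₂) * θ * Real.sin t) * F)) (-1 / 2) (1 / 2) := by
  have hrot (α : ℝ) : expI α * (p₁ • expI t + p₂ • F) * expI (-α) =
      p₁ • expI t + p₂ • (expI (2 * α) * F) := by
    rw [mul_add, add_mul, mul_smul_comm, smul_mul_assoc, mul_smul_comm, smul_mul_assoc,
      expI_mul_mul_expI_neg hF, expI_mul_expI, expI_mul_expI, add_neg_cancel_comm]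
  have hgen : p₁ • expI t + p₂ • F - ((p₁ + p₂) * Real.sin t) • matI =
      (p₁ * Real.cos t) • (1 : Matrix (Fin 2) (Fin 2) ℝ) + p₂ • (F - Real.sin t • matI) := by
    rw [expI_eq]
    module
  have h := leftExp_expI_conj (a := -1 / 2) (b := 1 / 2) (by norm_num) ((p₁ + p₂) * Real.sin t) 0
    (p₁ • expI t + p₂ • F)
  rw [hgen, show (1 / 2 - -1 / 2 : ℝ) = 1 by norm_num, one_smul, exp_smul_one_add,
    mul_smul_comm, smul_mul_assoc] at h
  simp only [hrot] at h
  rw [normalForm_eq_expI_mul_exp_mul_expI hF]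
  convert! h.symm using 4 <;> ring_nf

theorem leftExp_expI (hb : 0 ≤ b) (t : ℝ) :
    leftExp (fun _ => expI t) 0 b = Real.exp (b * Real.cos t) • expI (b * Real.sin t) := by
  rw [leftExp_const hb, sub_zero, expI_eq t, smul_add, smul_smul, smul_smul, exp_smul_one_add, expI]

theorem leftExp_expI_mul (hF : F ∈ conjK) (hb : 0 ≤ b) (θ₀ t : ℝ) :
    leftExp (fun θ => expI (2 * (θ - θ₀) * Real.sin t) * F) 0 b =
      expI ((b - θ₀) * Real.sin t) * exp (b • (F - Real.sin t • matI)) *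
        expI (θ₀ * Real.sin t) := by
  have h := leftExp_expI_conj hb (Real.sin t) θ₀ F
  simp only [expI_mul_mul_expI_neg hF, sub_zero, zero_sub, neg_mul, neg_neg, ← mul_assoc] at h
  exact h

theorem normalForm_eq_leftExp_mul_leftExp (hF : F ∈ conjK) {p₁ p₂ : ℝ} (h₁ : 0 ≤ p₁)
    (h₂ : 0 ≤ p₂) (t : ℝ) :
    normalForm p₁ p₂ t F = leftExp (fun _ => expI t) 0 p₁ *
      leftExp (fun θ => expI ((2 * θ - p₁ - p₂) * Real.sin t) * F) 0 p₂ := by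
  have hrot (θ : ℝ) : 2 * θ - p₁ - p₂ = 2 * (θ - (p₁ + p₂) / 2) := by ring
  simp only [hrot]
  rw [leftExp_expI h₁, leftExp_expI_mul hF h₂, normalForm_eq_expI_mul_exp_mul_expI hF,
    smul_mul_assoc, ← mul_assoc, ← mul_assoc, expI_mul_expI]
  congr 4 <;> ring

theorem normalForm_eq_leftExp_mul_leftExp' (hF : F ∈ conjK) {p₁ p₂ : ℝ} (h₁ : 0 ≤ p₁)
    (h₂ : 0 ≤ p₂) (t : ℝ) :
    normalForm p₁ p₂ t F =
      leftExp (fun θ => expI ((2 * θ + p₁ - p₂) * Real.sin t) * F) 0 p₂ *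
        leftExp (fun _ => expI t) 0 p₁ := by
  have hrot (θ : ℝ) : 2 * θ + p₁ - p₂ = 2 * (θ - (p₂ - p₁) / 2) := by ring
  simp only [hrot]
  rw [leftExp_expI h₁, leftExp_expI_mul hF h₂, normalForm_eq_expI_mul_exp_mul_expI hF,
    mul_smul_comm, mul_assoc _ (expI _) (expI _), expI_mul_expI]
  congr 4 <;> ring

end MatrixNorm

section NormalForm

/-- The matrix of the real-linear map `v ↦ z v + w v̄` of `ℂ` in the basis `1, i`. Every real
`2 × 2` matrix has this form, and its chiral disk is the closed disk with center `z` and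
radius `‖w‖`. -/
def chiralMatrix (z w : ℂ) : Matrix (Fin 2) (Fin 2) ℝ :=
  !![z.re + w.re, w.im - z.im; z.im + w.im, z.re - w.re]

theorem exists_eq_chiralMatrix (A : Matrix (Fin 2) (Fin 2) ℝ) :
    ∃ z w : ℂ, A = chiralMatrix z w := by
  refine ⟨⟨(A 0 0 + A 1 1) / 2, (A 1 0 - A 0 1) / 2⟩, ⟨(A 0 0 - A 1 1) / 2, (A 0 1 + A 1 0) / 2⟩,
    ?_⟩
  ext i j
  fin_cases i <;> fin_cases j <;> simp [chiralMatrix] <;> ring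

theorem chiralMatrix_inj {z w z' w' : ℂ} :
    chiralMatrix z w = chiralMatrix z' w' ↔ z = z' ∧ w = w' := by
  constructor
  · intro h
    have h00 := congrFun₂ h 0 0
    have h01 := congrFun₂ h 0 1
    have h10 := congrFun₂ h 1 0
    have h11 := congrFun₂ h 1 1
    simp only [chiralMatrix, Matrix.of_apply, Matrix.cons_val', Matrix.cons_val_zero,
      Matrix.cons_val_one, Matrix.cons_val_fin_one] at h00 h01 h10 h11
    constructor <;> apply Complex.ext <;> linarith
  · rintro ⟨rfl, rfl⟩
    rfl

theorem chiralMatrix_one_zero : chiralMatrix 1 0 = 1 := by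
  ext i j
  fin_cases i <;> fin_cases j <;> simp [chiralMatrix]

theorem chiralDisk_chiralMatrix (z w : ℂ) :
    chiralDisk (chiralMatrix z w) = Metric.closedBall z ‖w‖ := by
  have hcenter : (⟨(chiralMatrix z w 0 0 + chiralMatrix z w 1 1) / 2,
      (chiralMatrix z w 1 0 - chiralMatrix z w 0 1) / 2⟩ : ℂ) = z := by
    apply Complex.ext <;> simp [chiralMatrix]
    ring
  have hradius : ((chiralMatrix z w 0 0 - chiralMatrix z w 1 1) / 2) ^ 2 +
      ((chiralMatrix z w 0 1 + chiralMatrix z w 1 0) / 2) ^ 2 = Complex.normSq w := by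
    simp only [chiralMatrix, Matrix.of_apply, Matrix.cons_val', Matrix.cons_val_zero,
      Matrix.cons_val_one, Matrix.cons_val_fin_one, Complex.normSq_apply]
    ring
  rw [chiralDisk, hcenter, hradius, Complex.norm_def]

theorem mem_conjK_iff {F : Matrix (Fin 2) (Fin 2) ℝ} :
    F ∈ conjK ↔ ∃ u : ℂ, ‖u‖ = 1 ∧ F = chiralMatrix 0 u := by
  have hrot (β : ℝ) : -Real.sin β • matJ + Real.cos β • matK =
      chiralMatrix 0 (Complex.I * Complex.exp (β * Complex.I)) := by
    ext i j
    fin_cases i <;> fin_cases j <;>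
      simp [chiralMatrix, matJ, matK, Complex.exp_ofReal_mul_I_re, Complex.exp_ofReal_mul_I_im]
  constructor
  · rintro ⟨β, -, rfl⟩
    exact ⟨_, by simp [Complex.norm_exp_ofReal_mul_I], hrot β⟩
  · rintro ⟨u, hu, rfl⟩
    have hv : ‖-Complex.I * u‖ = 1 := by simp [hu]
    obtain ⟨β, hβ⟩ := (Complex.norm_eq_one_iff _).1 hv
    refine ⟨toIcoMod Real.two_pi_pos 0 β, by simpa using toIcoMod_mem_Ico Real.two_pi_pos 0 β, ?_⟩
    have hmod : Complex.exp ((toIcoMod Real.two_pi_pos 0 β : ℝ) * Complex.I) =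
        Complex.exp (β * Complex.I) := by
      rw [Complex.exp_eq_exp_iff_exists_int]
      refine ⟨-toIcoDiv Real.two_pi_pos 0 β, ?_⟩
      push_cast [toIcoMod, zsmul_eq_mul]
      ring
    rw [hrot, hmod, hβ, neg_mul, mul_neg, ← mul_assoc, Complex.I_mul_I, neg_one_mul, neg_neg]

/-- The center of the chiral disk of `normalForm p₁ p₂ t F` for `F ∈ conjK`. -/
noncomputable def normalCenter (p₁ p₂ t : ℝ) : ℂ :=
  Real.exp (p₁ * Real.cos t) * (Complex.exp (((p₁ + p₂) * Real.sin t : ℝ) * Complex.I) *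
    (Real.cosh (p₂ * Real.cos t) - (sinhQuot p₂ (Real.cos t) * Real.sin t : ℝ) * Complex.I))

/-- The radius of the chiral disk of `normalForm p₁ p₂ t F` for `F ∈ conjK`, when `0 ≤ p₂`. -/
noncomputable def normalRadius (p₁ p₂ t : ℝ) : ℝ :=
  Real.exp (p₁ * Real.cos t) * sinhQuot p₂ (Real.cos t)

theorem normalForm_chiralMatrix (p₁ p₂ t : ℝ) (u : ℂ) :
    normalForm p₁ p₂ t (chiralMatrix 0 u) =
      chiralMatrix (normalCenter p₁ p₂ t) (normalRadius p₁ p₂ t * u) := by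
  rw [normalForm, expI_eq]
  ext i j
  fin_cases i <;> fin_cases j <;>
    simp [chiralMatrix, matI, normalCenter, normalRadius, Matrix.mul_apply,
      Complex.exp_ofReal_mul_I_re, Complex.exp_ofReal_mul_I_im, -Complex.ofReal_mul,
      -Complex.ofReal_add, -Complex.ofReal_sin, -Complex.ofReal_cos, -Complex.ofReal_exp] <;>
    ring

theorem cos_eq_or_eq_neg_of_sin_eq {t t' : ℝ} (h : Real.sin t' = Real.sin t) :
    Real.cos t' = Real.cos t ∨ Real.cos t' = -Real.cos t := by
  rw [← sq_eq_sq_iff_eq_or_eq_neg, Real.cos_sq', Real.cos_sq', h]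

theorem strictMono_sinhQuot (x : ℝ) : StrictMono fun q => sinhQuot q x :=
  strictMono_of_deriv_pos fun q => by
    rw [(hasDerivAt_sinhQuot x q).deriv]
    exact Real.cosh_pos _

theorem sinhQuot_pos {q : ℝ} (hq : 0 < q) (x : ℝ) : 0 < sinhQuot q x := by
  simpa only [sinhQuot_zero_left] using strictMono_sinhQuot x hq

theorem normalRadius_zero_right (p t : ℝ) : normalRadius p 0 t = 0 := by
  rw [normalRadius, sinhQuot_zero_left, mul_zero]

theorem normalRadius_zero_left (p t : ℝ) : normalRadius 0 p t = sinhQuot p (Real.cos t) := by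
  rw [normalRadius, zero_mul, Real.exp_zero, one_mul]

theorem normalRadius_pos {p₂ : ℝ} (h : 0 < p₂) (p₁ t : ℝ) : 0 < normalRadius p₁ p₂ t :=
  mul_pos (Real.exp_pos _) (sinhQuot_pos h _)

theorem normalRadius_nonneg {p₂ : ℝ} (h : 0 ≤ p₂) (p₁ t : ℝ) : 0 ≤ normalRadius p₁ p₂ t := by
  rcases h.eq_or_lt with rfl | h
  · rw [normalRadius_zero_right]
  · exact (normalRadius_pos h p₁ t).le

/-- The chiral disk of `normalForm p₁ p₂ t F` for `F ∈ conjK` and `0 ≤ p₂`. -/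
def normalDisk (p₁ p₂ t : ℝ) : Set ℂ :=
  Metric.closedBall (normalCenter p₁ p₂ t) (normalRadius p₁ p₂ t)

theorem chiralDisk_normalForm {F : Matrix (Fin 2) (Fin 2) ℝ} (hF : F ∈ conjK) {p₂ : ℝ}
    (h₂ : 0 ≤ p₂) (p₁ t : ℝ) :
    chiralDisk (normalForm p₁ p₂ t F) = normalDisk p₁ p₂ t := by
  obtain ⟨u, hu, rfl⟩ := mem_conjK_iff.1 hF
  rw [normalForm_chiralMatrix, chiralDisk_chiralMatrix, norm_mul, hu, mul_one,
    Complex.norm_of_nonneg (normalRadius_nonneg h₂ p₁ t), normalDisk]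

theorem normalRadius_zero_left_congr {t t' : ℝ} (h : Real.sin t' = Real.sin t) (p : ℝ) :
    normalRadius 0 p t' = normalRadius 0 p t := by
  rcases cos_eq_or_eq_neg_of_sin_eq h with hc | hc <;> simp [normalRadius, sinhQuot, hc]

theorem normalCenter_zero_left_congr {t t' : ℝ} (h : Real.sin t' = Real.sin t) (p : ℝ) :
    normalCenter 0 p t' = normalCenter 0 p t := by
  rcases cos_eq_or_eq_neg_of_sin_eq h with hc | hc <;> simp [normalCenter, sinhQuot, h, hc]

theorem normalDisk_zero_left_congr {t t' : ℝ} (h : Real.sin t' = Real.sin t) (p : ℝ) :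
    normalDisk 0 p t' = normalDisk 0 p t := by
  rw [normalDisk, normalDisk, normalCenter_zero_left_congr h, normalRadius_zero_left_congr h]

theorem normalForm_zero_left_congr {t t' : ℝ} (h : Real.sin t' = Real.sin t) (p : ℝ)
    (F : Matrix (Fin 2) (Fin 2) ℝ) : normalForm 0 p t' F = normalForm 0 p t F := by
  rcases cos_eq_or_eq_neg_of_sin_eq h with hc | hc <;> simp [normalForm, sinhQuot, h, hc]

theorem hasDerivAt_normalRadius (p q t : ℝ) :
    HasDerivAt (fun q => normalRadius (p - q) q t)
      (Real.exp ((p - q) * Real.cos t) * Real.exp (-(q * Real.cos t))) q := by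
  have hexponent : HasDerivAt (fun q : ℝ => (p - q) * Real.cos t) (-Real.cos t) q := by
    simpa using ((hasDerivAt_id q).const_sub p).mul_const (Real.cos t)
  refine (hexponent.exp.fun_mul (hasDerivAt_sinhQuot (Real.cos t) q)).congr_deriv ?_
  rw [← Real.cosh_sub_sinh, ← mul_sinhQuot]
  ring

theorem strictMono_normalRadius (p t : ℝ) : StrictMono fun q => normalRadius (p - q) q t :=
  strictMono_of_deriv_pos fun q => by
    rw [(hasDerivAt_normalRadius p q t).deriv]
    positivity

theorem exists_normalRadius_eq {p q r t : ℝ} (hq : 0 ≤ q) (hr : 0 ≤ r)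
    (hrq : r ≤ normalRadius (p - q) q t) :
    ∃ q' ∈ Set.Icc 0 q, normalRadius (p - q') q' t = r := by
  have hcont : Continuous fun q => normalRadius (p - q) q t :=
    continuous_iff_continuousAt.2 fun q => (hasDerivAt_normalRadius p q t).continuousAt
  exact intermediate_value_Icc hq hcont.continuousOn
    ⟨by simpa only [normalRadius_zero_right] using hr, hrq⟩

/-- The image `exp (p (cos t + i sin t))` of the point with argument `t` on the circle of
radius `p` around `0`. -/
noncomputable def boundaryPoint (p t : ℝ) : ℂ :=
  Complex.exp (p * (Real.cos t + Complex.I * Real.sin t))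

/-- The outer unit normal at `boundaryPoint p t` of the image under `exp` of the disk of radius
`p` around `0`, when `0 < p < π`: the direction of `exp' z * z` for `z = p (cos t + i sin t)`. -/
noncomputable def outerNormal (p t : ℝ) : ℂ :=
  Complex.exp ((t + p * Real.sin t : ℝ) * Complex.I)

theorem norm_outerNormal (p t : ℝ) : ‖outerNormal p t‖ = 1 :=
  Complex.norm_exp_ofReal_mul_I _

theorem boundaryPoint_eq (p t : ℝ) :
    boundaryPoint p t =
      Real.exp (p * Real.cos t) * Complex.exp ((p * Real.sin t : ℝ) * Complex.I) := by
  rw [boundaryPoint, Complex.ofReal_exp, ← Complex.exp_add]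
  push_cast
  ring_nf

theorem outerNormal_eq (p t : ℝ) :
    outerNormal p t = Complex.exp ((p * Real.sin t : ℝ) * Complex.I) *
      (Real.cos t + Real.sin t * Complex.I) := by
  rw [outerNormal, Complex.ofReal_add, add_mul, add_comm, Complex.exp_add,
    Complex.exp_mul_I (t : ℂ), Complex.ofReal_cos, Complex.ofReal_sin]

theorem normalCenter_eq (p₁ p₂ t : ℝ) :
    normalCenter p₁ p₂ t =
      boundaryPoint (p₁ + p₂) t - normalRadius p₁ p₂ t • outerNormal (p₁ + p₂) t := by
  have hexp : (Real.exp ((p₁ + p₂) * Real.cos t) : ℂ) = Real.exp (p₁ * Real.cos t) *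
      (Real.cosh (p₂ * Real.cos t) + Real.cos t * sinhQuot p₂ (Real.cos t)) := by
    rw [add_mul, Real.exp_add, ← Real.cosh_add_sinh (p₂ * Real.cos t), ← mul_sinhQuot]
    push_cast
    ring
  rw [normalCenter, boundaryPoint_eq, hexp, outerNormal_eq, normalRadius, Complex.real_smul]
  push_cast
  ring

theorem boundaryPoint_mem_normalDisk {p₂ : ℝ} (h₂ : 0 ≤ p₂) (p₁ t : ℝ) :
    boundaryPoint (p₁ + p₂) t ∈ normalDisk p₁ p₂ t := by
  rw [normalDisk, Metric.mem_closedBall, dist_eq_norm, normalCenter_eq, sub_sub_cancel, norm_smul,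
    norm_outerNormal, mul_one, Real.norm_of_nonneg (normalRadius_nonneg h₂ p₁ t)]

end NormalForm

section Filling

theorem eq_mul_exp_integral {f g : ℝ → ℂ} (hg : Continuous g)
    (hf : ∀ x, HasDerivAt f (g x * f x) x) (a b : ℝ) :
    f b = f a * Complex.exp (∫ x in a..b, g x) := by
  have hprimitive (x : ℝ) : HasDerivAt (fun x => ∫ y in a..x, g y) (g x) x :=
    (hg.integral_hasStrictDerivAt a x).hasDerivAt
  have hconst (x : ℝ) : HasDerivAt (fun x => f x * Complex.exp (-∫ y in a..x, g y)) 0 x := by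
    refine ((hf x).mul (hprimitive x).neg.cexp).congr_deriv ?_
    ring
  have h := is_const_of_deriv_eq_zero (fun x => (hconst x).differentiableAt)
    (fun x => (hconst x).deriv) b a
  simp only [intervalIntegral.integral_same, neg_zero, Complex.exp_zero, mul_one] at h
  rw [← h, mul_assoc, ← Complex.exp_add, neg_add_cancel, Complex.exp_zero, mul_one]

theorem eqOn_const_of_norm_integral_eq {E : Type*} [NormedAddCommGroup E] [NormedSpace ℝ E]
    [StrictConvexSpace ℝ E] [CompleteSpace E] {g : ℝ → E} (hg : Continuous g) {a b C : ℝ}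
    (hab : a < b) (hC : ∀ x, ‖g x‖ ≤ C) (h : ‖∫ x in a..b, g x‖ = (b - a) * C) :
    ∃ v, Set.EqOn g (fun _ => v) (Set.Icc a b) := by
  rw [intervalIntegral.integral_of_le hab.le, ← MeasureTheory.integral_Icc_eq_integral_Ioc] at h
  rcases ae_eq_const_or_norm_setIntegral_lt_of_norm_le_const (f := g) (C := C)
    (μ := MeasureTheory.volume) measure_Icc_lt_top.ne (.of_forall hC) with hconst | hlt
  · exact ⟨_, MeasureTheory.Measure.eqOn_Icc_of_ae_eq _ hab.ne hconst hg.continuousOn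
      continuousOn_const⟩
  · rw [h, Real.volume_real_Icc_of_le hab.le] at hlt
    exact absurd hlt (lt_irrefl _)

theorem exists_mem_sphere_of_mem_closedBall {E : Type*} [NormedAddCommGroup E] [NormedSpace ℝ E]
    {c v x : E} {R : ℝ} (hx : x ∈ Metric.closedBall (c - R • v) R) :
    ∃ r ∈ Set.Icc 0 R, x ∈ Metric.sphere (c - r • v) r := by
  have hR : 0 ≤ R := Metric.nonempty_closedBall.1 ⟨x, hx⟩
  have hcont : Continuous fun r : ℝ => dist x (c - r • v) - r := by fun_prop
  obtain ⟨r, hr, hr0⟩ := intermediate_value_Icc' hR hcont.continuousOn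
    ⟨sub_nonpos.2 hx, by simpa only [sub_zero] using dist_nonneg⟩
  exact ⟨r, hr, sub_eq_zero.1 hr0⟩

/-- The point with direction `η` on the boundary circle of the disk with center
`normalCenter 0 q t` and radius `normalRadius 0 q t`, after a rotation by `-q sin t`. -/
noncomputable def rotatedCirclePoint (t : ℝ) (η : ℂ) (q : ℝ) : ℂ :=
  Real.cosh (q * Real.cos t) + sinhQuot q (Real.cos t) * (η - Complex.I * Real.sin t)

variable {η : ℂ}

theorem rotatedCirclePoint_zero (t : ℝ) (η : ℂ) : rotatedCirclePoint t η 0 = 1 := by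
  simp [rotatedCirclePoint, sinhQuot_zero_left]

theorem hasDerivAt_rotatedCirclePoint (t : ℝ) (η : ℂ) (q : ℝ) :
    HasDerivAt (rotatedCirclePoint t η) ((Real.cos t ^ 2 * sinhQuot q (Real.cos t) : ℝ) +
      Real.cosh (q * Real.cos t) * (η - Complex.I * Real.sin t)) q :=
  (hasDerivAt_cosh_mul (Real.cos t) q).ofReal_comp.add
    ((hasDerivAt_sinhQuot (Real.cos t) q).ofReal_comp.mul_const _)

theorem continuous_rotatedCirclePoint (t : ℝ) (η : ℂ) : Continuous (rotatedCirclePoint t η) :=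
  continuous_iff_continuousAt.2 fun q => (hasDerivAt_rotatedCirclePoint t η q).continuousAt

theorem cosh_sq_eq_one_add_sinhQuot (q x : ℝ) :
    Real.cosh (q * x) ^ 2 = 1 + (x * sinhQuot q x) ^ 2 := by
  rw [Real.cosh_sq', mul_sinhQuot]

theorem rotatedCirclePoint_ne_zero (hη : ‖η‖ = 1) (t q : ℝ) : rotatedCirclePoint t η q ≠ 0 := by
  intro h
  have hη' : η.re * η.re + η.im * η.im = 1 := by
    rw [← Complex.normSq_apply, Complex.normSq_eq_norm_sq, hη, one_pow]
  have hre := congrArg Complex.re h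
  have him := congrArg Complex.im h
  simp only [rotatedCirclePoint, Complex.add_re, Complex.add_im, Complex.re_ofReal_mul,
    Complex.im_ofReal_mul, Complex.sub_re, Complex.sub_im, Complex.re_mul_ofReal,
    Complex.im_mul_ofReal, Complex.I_re, Complex.I_im, Complex.ofReal_re, Complex.ofReal_im,
    Complex.zero_re, Complex.zero_im, one_mul, zero_mul, sub_zero, zero_add] at hre him
  refine one_ne_zero (α := ℝ) ?_
  linear_combination
    (Real.cosh (q * Real.cos t) - sinhQuot q (Real.cos t) * η.re) * hre -
    sinhQuot q (Real.cos t) * (η.im + Real.sin t) * him + sinhQuot q (Real.cos t) ^ 2 * hη' -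
    cosh_sq_eq_one_add_sinhQuot q (Real.cos t) -
    sinhQuot q (Real.cos t) ^ 2 * Real.sin_sq_add_cos_sq t

theorem deriv_rotatedCirclePoint_add (hη : ‖η‖ = 1) (t q : ℝ) :
    (Real.cos t ^ 2 * sinhQuot q (Real.cos t) : ℝ) +
        Real.cosh (q * Real.cos t) * (η - Complex.I * Real.sin t) +
        Complex.I * Real.sin t * rotatedCirclePoint t η q =
      η * (starRingEnd ℂ) (rotatedCirclePoint t η q) := by
  have hη' : η * (starRingEnd ℂ) η = 1 := by
    rw [Complex.mul_conj, Complex.normSq_eq_norm_sq, hη, one_pow, Complex.ofReal_one]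
  have ht : (Real.cos t : ℂ) ^ 2 + Real.sin t ^ 2 = 1 := by
    exact_mod_cast Real.cos_sq_add_sin_sq t
  simp only [rotatedCirclePoint, map_add, map_sub, map_mul, Complex.conj_ofReal, Complex.conj_I]
  push_cast at ht ⊢
  linear_combination (sinhQuot q (Real.cos t) : ℂ) * (ht - hη') -
    (sinhQuot q (Real.cos t) : ℂ) * Complex.sin t ^ 2 * Complex.I_sq

/-- The logarithmic derivative of `q ↦ exp (i q sin t) * rotatedCirclePoint t η q`. -/
noncomputable def circleVelocity (t : ℝ) (η : ℂ) (q : ℝ) : ℂ :=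
  η * (starRingEnd ℂ) (rotatedCirclePoint t η q) / rotatedCirclePoint t η q

theorem continuous_circleVelocity (hη : ‖η‖ = 1) (t : ℝ) : Continuous (circleVelocity t η) :=
  (continuous_const.mul (Complex.continuous_conj.comp (continuous_rotatedCirclePoint t η))).div
    (continuous_rotatedCirclePoint t η) (rotatedCirclePoint_ne_zero hη t)

theorem norm_circleVelocity (hη : ‖η‖ = 1) (t q : ℝ) : ‖circleVelocity t η q‖ = 1 := by
  rw [circleVelocity, norm_div, norm_mul, hη, one_mul, RCLike.norm_conj,
    div_self (norm_ne_zero_iff.2 (rotatedCirclePoint_ne_zero hη t q))]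

theorem exp_integral_circleVelocity (hη : ‖η‖ = 1) (t q : ℝ) :
    Complex.exp (∫ x in 0..q, circleVelocity t η x) =
      Complex.exp ((q * Real.sin t : ℝ) * Complex.I) * rotatedCirclePoint t η q := by
  have hderiv (x : ℝ) : HasDerivAt
      (fun x : ℝ => Complex.exp ((x * Real.sin t : ℝ) * Complex.I) * rotatedCirclePoint t η x)
      (circleVelocity t η x *
        (Complex.exp ((x * Real.sin t : ℝ) * Complex.I) * rotatedCirclePoint t η x)) x := by
    refine (((hasDerivAt_mul_const (Real.sin t)).ofReal_comp.mul_const Complex.I).cexp.mul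
      (hasDerivAt_rotatedCirclePoint t η x)).congr_deriv ?_
    have hvelocity := div_mul_cancel₀ (η * (starRingEnd ℂ) (rotatedCirclePoint t η x))
      (rotatedCirclePoint_ne_zero hη t x)
    rw [← circleVelocity, ← deriv_rotatedCirclePoint_add hη] at hvelocity
    linear_combination -Complex.exp ((x * Real.sin t : ℝ) * Complex.I) * hvelocity
  have h := eq_mul_exp_integral (continuous_circleVelocity hη t) hderiv 0 q
  rw [rotatedCirclePoint_zero, zero_mul, Complex.ofReal_zero, zero_mul, Complex.exp_zero, one_mul,
    one_mul] at h
  exact h.symm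

theorem norm_integral_circleVelocity_le (hη : ‖η‖ = 1) (t : ℝ) {q : ℝ} (hq : 0 ≤ q) :
    ‖∫ x in 0..q, circleVelocity t η x‖ ≤ q := by
  have h := intervalIntegral.norm_integral_le_of_norm_le_const (a := 0) (b := q)
    fun x _ => (norm_circleVelocity hη t x).le
  rwa [one_mul, sub_zero, abs_of_nonneg hq] at h

/-- A curve of speed one whose length equals its displacement is a segment; here this forces
`η.im = sin t`, because the initial and the final velocity agree. -/
theorem im_integral_circleVelocity (hη : ‖η‖ = 1) {t q : ℝ} (hq : 0 ≤ q)
    (h : ‖∫ x in 0..q, circleVelocity t η x‖ = q) :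
    (∫ x in 0..q, circleVelocity t η x).im = q * Real.sin t := by
  rcases hq.eq_or_lt with rfl | hq
  · rw [intervalIntegral.integral_same, Complex.zero_im, zero_mul]
  obtain ⟨v, hv⟩ := eqOn_const_of_norm_integral_eq (continuous_circleVelocity hη t) hq
    (fun x => (norm_circleVelocity hη t x).le) (by rw [h, sub_zero, mul_one])
  have hvη : η = v := by
    simpa [circleVelocity, rotatedCirclePoint_zero] using hv (Set.left_mem_Icc.2 hq.le)
  subst hvη
  have hreal : (starRingEnd ℂ) (rotatedCirclePoint t η q) = rotatedCirclePoint t η q := by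
    have hη0 : η ≠ 0 := norm_ne_zero_iff.1 (by rw [hη]; exact one_ne_zero)
    refine mul_left_cancel₀ hη0 ?_
    rw [← div_eq_iff (rotatedCirclePoint_ne_zero hη t q), ← circleVelocity,
      hv (Set.right_mem_Icc.2 hq.le)]
  have him : η.im = Real.sin t := by
    have h0 := Complex.conj_eq_iff_im.1 hreal
    simp only [rotatedCirclePoint, Complex.add_im, Complex.ofReal_im, Complex.im_ofReal_mul,
      Complex.sub_im, Complex.im_mul_ofReal, Complex.I_im, one_mul, zero_add] at h0
    exact sub_eq_zero.1 ((mul_eq_zero.1 h0).resolve_left (sinhQuot_pos hq _).ne')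
  rw [intervalIntegral.integral_congr fun x hx => hv (Set.uIcc_of_le hq.le ▸ hx),
    intervalIntegral.integral_const, sub_zero, Complex.smul_im, him, smul_eq_mul]

variable {p₁ p₂ t : ℝ}

theorem exists_exp_eq_of_mem_sphere (h₂ : 0 ≤ p₂) {ζ : ℂ}
    (hζ : ζ ∈ Metric.sphere (normalCenter p₁ p₂ t) (normalRadius p₁ p₂ t)) :
    ∃ w : ℂ, ‖w‖ ≤ p₂ ∧ (‖w‖ = p₂ → w.im = p₂ * Real.sin t) ∧
      Complex.exp (p₁ * (Real.cos t + Complex.I * Real.sin t) + w) = ζ := by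
  rw [← abs_of_nonneg (normalRadius_nonneg h₂ p₁ t), ← range_circleMap] at hζ
  obtain ⟨θ, rfl⟩ := hζ
  have hη := Complex.norm_exp_ofReal_mul_I (θ - (p₁ + p₂) * Real.sin t)
  refine ⟨_, norm_integral_circleVelocity_le hη t h₂, im_integral_circleVelocity hη h₂, ?_⟩
  have hθ : Complex.exp (θ * Complex.I) =
      Complex.exp (((p₁ + p₂) * Real.sin t : ℝ) * Complex.I) *
        Complex.exp ((θ - (p₁ + p₂) * Real.sin t : ℝ) * Complex.I) := by
    rw [← Complex.exp_add]
    push_cast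
    ring_nf
  rw [Complex.exp_add, ← boundaryPoint, exp_integral_circleVelocity hη, boundaryPoint_eq,
    circleMap, hθ, normalCenter, normalRadius, rotatedCirclePoint, add_mul, Complex.ofReal_add,
    add_mul, Complex.exp_add]
  push_cast
  ring

theorem norm_mul_cos_add_I_mul_sin {p : ℝ} (hp : 0 ≤ p) (t : ℝ) :
    ‖(p * (Real.cos t + Complex.I * Real.sin t) : ℂ)‖ = p := by
  rw [mul_comm Complex.I, Complex.ofReal_cos, Complex.ofReal_sin, ← Complex.exp_mul_I, norm_mul,
    Complex.norm_exp_ofReal_mul_I, mul_one, Complex.norm_of_nonneg hp]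

theorem exists_exp_eq_of_mem_normalDisk (h₁ : 0 ≤ p₁) (h₂ : 0 ≤ p₂) {ζ : ℂ}
    (hζ : ζ ∈ normalDisk p₁ p₂ t) :
    ∃ w : ℂ, ‖w‖ ≤ p₁ + p₂ ∧ Complex.exp w = ζ ∧
      (‖w‖ = p₁ + p₂ → w.im = (p₁ + p₂) * Real.sin t ∧
        (0 < p₁ → w.re = (p₁ + p₂) * Real.cos t)) := by
  obtain ⟨r, hr, hζr⟩ := exists_mem_sphere_of_mem_closedBall (x := ζ)
    (c := boundaryPoint (p₁ + p₂) t) (v := outerNormal (p₁ + p₂) t) (R := normalRadius p₁ p₂ t)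
    (by rwa [← normalCenter_eq])
  obtain ⟨q, hq, rfl⟩ := exists_normalRadius_eq (p := p₁ + p₂) h₂ hr.1
    (by rw [add_sub_cancel_right]; exact hr.2)
  set p := p₁ + p₂ with hp
  have hq₁ : p₁ ≤ p - q := by linarith [hq.2]
  have hcenter := normalCenter_eq (p - q) q t
  rw [sub_add_cancel] at hcenter
  rw [← hcenter] at hζr
  obtain ⟨w, hw, him, hexp⟩ := exists_exp_eq_of_mem_sphere hq.1 hζr
  have hnorm := norm_mul_cos_add_I_mul_sin (h₁.trans hq₁) t
  have hle := norm_add_le (((p - q : ℝ) : ℂ) * (Real.cos t + Complex.I * Real.sin t)) w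
  rw [hnorm] at hle
  refine ⟨_, hle.trans (by linarith), hexp, fun heq => ?_⟩
  have hwq : ‖w‖ = q := by linarith
  refine ⟨?_, fun hpos => ?_⟩
  · simp only [Complex.add_im, Complex.im_ofReal_mul, Complex.im_mul_ofReal, Complex.ofReal_im,
      Complex.I_im, him hwq]
    ring
  · have hray := (sameRay_iff_norm_add.2 (by rw [heq, hnorm, hwq]; ring)).norm_smul_eq
    rw [hnorm, hwq, Complex.real_smul, Complex.real_smul] at hray
    have hre := congrArg Complex.re hray
    simp only [Complex.add_re, Complex.re_ofReal_mul, Complex.ofReal_re, Complex.re_mul_ofReal,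
      Complex.I_re, zero_mul, add_zero] at hre ⊢
    have : w.re = q * Real.cos t :=
      mul_left_cancel₀ (hpos.trans_le hq₁).ne' (by linarith)
    rw [this]
    ring

theorem normalDisk_subset_image_exp (h₁ : 0 ≤ p₁) (h₂ : 0 ≤ p₂) (t : ℝ) :
    normalDisk p₁ p₂ t ⊆ Complex.exp '' Metric.closedBall 0 (p₁ + p₂) := by
  intro ζ hζ
  obtain ⟨w, hw, hexp, -⟩ := exists_exp_eq_of_mem_normalDisk h₁ h₂ hζ
  exact ⟨w, mem_closedBall_zero_iff.2 hw, hexp⟩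

theorem injOn_exp_ball_pi : Set.InjOn Complex.exp (Metric.ball 0 Real.pi) := by
  intro w hw z hz h
  rw [mem_ball_zero_iff] at hw hz
  have hw' := abs_lt.1 ((Complex.abs_im_le_norm w).trans_lt hw)
  have hz' := abs_lt.1 ((Complex.abs_im_le_norm z).trans_lt hz)
  exact Complex.exp_inj_of_neg_pi_lt_of_le_pi hw'.1 hw'.2.le hz'.1 hz'.2.le h

theorem eq_of_exp_eq_boundaryPoint {p τ : ℝ} {w : ℂ} (hp : 0 ≤ p) (hpπ : p < Real.pi)
    (hw : ‖w‖ < Real.pi) (h : Complex.exp w = boundaryPoint p τ) :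
    w = p * (Real.cos τ + Complex.I * Real.sin τ) :=
  injOn_exp_ball_pi (mem_ball_zero_iff.2 hw)
    (mem_ball_zero_iff.2 (by rwa [norm_mul_cos_add_I_mul_sin hp])) h

theorem le_of_boundaryPoint_mem_image {p r τ : ℝ} (hp : 0 ≤ p) (hpπ : p < Real.pi)
    (hr : r < Real.pi) (h : boundaryPoint p τ ∈ Complex.exp '' Metric.closedBall 0 r) : p ≤ r := by
  obtain ⟨w, hw, hexp⟩ := h
  rw [mem_closedBall_zero_iff] at hw
  rwa [eq_of_exp_eq_boundaryPoint hp hpπ (hw.trans_lt hr) hexp, norm_mul_cos_add_I_mul_sin hp] at hw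

theorem sin_eq_and_cos_eq_of_boundaryPoint_mem_normalDisk {τ : ℝ} (h₁ : 0 ≤ p₁) (h₂ : 0 ≤ p₂)
    (h0 : 0 < p₁ + p₂) (hπ : p₁ + p₂ < Real.pi)
    (h : boundaryPoint (p₁ + p₂) τ ∈ normalDisk p₁ p₂ t) :
    Real.sin τ = Real.sin t ∧ (0 < p₁ → Real.cos τ = Real.cos t) := by
  obtain ⟨w, hw, hexp, htouch⟩ := exists_exp_eq_of_mem_normalDisk h₁ h₂ h
  obtain rfl := eq_of_exp_eq_boundaryPoint h0.le hπ (hw.trans_lt hπ) hexp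
  obtain ⟨him, hre⟩ := htouch (norm_mul_cos_add_I_mul_sin h0.le τ)
  simp only [Complex.im_ofReal_mul, Complex.re_ofReal_mul, Complex.add_im, Complex.add_re,
    Complex.im_mul_ofReal, Complex.re_mul_ofReal, Complex.ofReal_im, Complex.ofReal_re,
    Complex.I_im, Complex.I_re, one_mul, zero_mul, zero_add, add_zero] at him hre
  exact ⟨mul_left_cancel₀ h0.ne' him, fun hpos => mul_left_cancel₀ h0.ne' (hre hpos)⟩

end Filling

section TangentBalls

variable {E : Type*} [NormedAddCommGroup E] [NormedSpace ℝ E]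

theorem closedBall_sub_smul_subset {n : E} (hn : ‖n‖ ≤ 1) (x : E) {r R : ℝ} (h : r ≤ R) :
    Metric.closedBall (x - r • n) r ⊆ Metric.closedBall (x - R • n) R := by
  refine Metric.closedBall_subset_closedBall' ?_
  have hdist : dist (x - r • n) (x - R • n) ≤ R - r := by
    rw [dist_eq_norm, sub_sub_sub_cancel_left, ← sub_smul, norm_smul,
      Real.norm_of_nonneg (sub_nonneg.2 h)]
    exact mul_le_of_le_one_right (sub_nonneg.2 h) hn
  linarith

theorem mem_ball_sub_smul_of_mem_closedBall [StrictConvexSpace ℝ E] {n x y : E} (hn : ‖n‖ = 1)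
    {r R : ℝ} (hrR : r < R) (hy : y ∈ Metric.closedBall (x - r • n) r) (hyx : y ≠ x) :
    y ∈ Metric.ball (x - R • n) R := by
  rw [Metric.mem_closedBall, dist_eq_norm] at hy
  rw [Metric.mem_ball, dist_eq_norm]
  have hsplit : y - (x - R • n) = (y - (x - r • n)) + (R - r) • n := by
    rw [sub_smul]
    abel
  have hshift : ‖(R - r) • n‖ = R - r := by
    rw [norm_smul, hn, mul_one, Real.norm_of_nonneg (sub_pos.2 hrR).le]
  refine lt_of_le_of_ne ?_ fun heq => hyx ?_
  · rw [hsplit]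
    linarith [norm_add_le (y - (x - r • n)) ((R - r) • n)]
  · have hnorm : ‖y - (x - r • n)‖ = r := by
      rw [hsplit] at heq
      linarith [norm_add_le (y - (x - r • n)) ((R - r) • n)]
    have hray : SameRay ℝ (y - (x - r • n)) ((R - r) • n) := by
      rw [sameRay_iff_norm_add, ← hsplit, heq, hnorm, hshift]
      ring
    have hsmul := hray.norm_smul_eq
    rw [hnorm, hshift, smul_comm, smul_right_inj (sub_pos.2 hrR).ne'] at hsmul
    rwa [← sub_add, right_eq_add, sub_eq_zero] at hsmul

theorem le_of_closedBall_subset_closedBall [Nontrivial E] {x y : E} {r s : ℝ} (hr : 0 ≤ r)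
    (h : Metric.closedBall x r ⊆ Metric.closedBall y s) : r ≤ s := by
  have hs : 0 ≤ s := Metric.nonempty_closedBall.1 ((Metric.nonempty_closedBall.2 hr).mono h)
  have hdiam := Metric.diam_mono h Metric.isBounded_closedBall
  rw [Metric.diam_closedBall_eq x hr, Metric.diam_closedBall_eq y hs] at hdiam
  linarith

theorem deriv_deriv_nonneg_of_isLocalMin {f : ℝ → ℝ} {a : ℝ} (h : IsLocalMin f a)
    (hc : ContinuousAt f a) : 0 ≤ deriv (deriv f) a := by
  by_contra! hneg
  have hmax := isLocalMax_of_deriv_deriv_neg hneg h.deriv_eq_zero hc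
  have hconst : f =ᶠ[nhds a] fun _ => f a := by
    filter_upwards [h, hmax] with x hmin hmax using le_antisymm hmax hmin
  have hderiv : deriv f =ᶠ[nhds a] fun _ => 0 := by
    simpa only [deriv_const'] using hconst.deriv
  simp [hderiv.deriv_eq] at hneg

theorem nonneg_of_hasDerivAt_of_isLocalMinOn_Ici {f : ℝ → ℝ} {f' a : ℝ} (hf : HasDerivAt f f' a)
    (h : IsLocalMinOn f (Set.Ici a) a) : 0 ≤ f' := by
  have hcone : (1 : ℝ) ∈ posTangentConeAt (Set.Ici a) a :=
    mem_posTangentConeAt_of_segment_subset <|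
      (convex_Ici a).segment_subset Set.self_mem_Ici (by simp)
  simpa using h.hasFDerivWithinAt_nonneg hf.hasDerivWithinAt.hasFDerivWithinAt hcone

open scoped ComplexOrder in
theorem eq_norm_mul_of_conj_mul_nonneg {w n : ℂ} (hn : ‖n‖ = 1)
    (h : 0 ≤ starRingEnd ℂ w * n) : w = ‖w‖ * n := by
  have hnorm := Complex.eq_coe_norm_of_nonneg h
  rw [norm_mul, hn, mul_one, Complex.norm_conj] at hnorm
  have hn2 : starRingEnd ℂ n * n = 1 := by rw [Complex.conj_mul', hn]; simp
  have hconj := congrArg (starRingEnd ℂ) hnorm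
  rw [map_mul, Complex.conj_conj, Complex.conj_ofReal] at hconj
  linear_combination n * hconj - w * hn2

end TangentBalls

section TangentDisk

theorem hasDerivAt_boundaryPoint_arg (p t : ℝ) :
    HasDerivAt (fun τ => boundaryPoint p τ)
      ((p * Real.exp (p * Real.cos t)) • (Complex.I * outerNormal p t)) t := by
  have h := ((((Real.hasDerivAt_cos t).ofReal_comp).add
    (((Real.hasDerivAt_sin t).ofReal_comp).const_mul Complex.I)).const_mul (p : ℂ)).cexp
  refine h.congr_deriv ?_
  change boundaryPoint p t * _ = _
  rw [boundaryPoint_eq, outerNormal_eq, Complex.real_smul]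
  push_cast
  linear_combination (-Complex.exp (p * Complex.cos t) *
    Complex.exp (p * Complex.sin t * Complex.I) * p * Complex.sin t) * Complex.I_mul_I

theorem hasDerivAt_boundaryPoint_radius (p t : ℝ) :
    HasDerivAt (fun q => boundaryPoint q t) (Real.exp (p * Real.cos t) • outerNormal p t) p := by
  have h := (((hasDerivAt_id p).ofReal_comp).mul_const
    ((Real.cos t : ℂ) + Complex.I * (Real.sin t : ℂ))).cexp
  refine h.congr_deriv ?_
  change boundaryPoint p t * _ = _
  rw [boundaryPoint_eq, outerNormal_eq, Complex.real_smul]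
  push_cast
  ring

theorem hasDerivAt_outerNormal (p t : ℝ) :
    HasDerivAt (outerNormal p) ((1 + p * Real.cos t) • (Complex.I * outerNormal p t)) t := by
  have h := (((hasDerivAt_id t).add ((Real.hasDerivAt_sin t).const_mul p)).ofReal_comp.mul_const
    Complex.I).cexp
  refine h.congr_deriv ?_
  change outerNormal p t * _ = _
  rw [Complex.real_smul]
  ring

theorem norm_boundaryPoint (p t : ℝ) : ‖boundaryPoint p t‖ = Real.exp (p * Real.cos t) := by
  rw [boundaryPoint_eq, norm_mul, Complex.norm_exp_ofReal_mul_I, mul_one,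
    Complex.norm_of_nonneg (Real.exp_pos _).le]

variable {p r t : ℝ} {z : ℂ}

theorem le_norm_boundaryPoint_sub_of_subset (hp : 0 ≤ p) (hpπ : p < Real.pi)
    (hsub : Metric.closedBall z r ⊆ Complex.exp '' Metric.closedBall 0 p) (τ : ℝ) {q : ℝ}
    (hq : q ∈ Set.Icc p Real.pi) : r ≤ ‖boundaryPoint q τ - z‖ := by
  have hopen : Set.Ioo p Real.pi ⊆ {q | r ≤ ‖boundaryPoint q τ - z‖} := fun q hq => by
    by_contra hlt
    rw [Set.mem_ofPred_eq, not_le, ← dist_eq_norm] at hlt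
    exact hq.1.not_ge (le_of_boundaryPoint_mem_image (hp.trans hq.1.le) hq.2 hpπ (hsub hlt.le))
  have hcont : Continuous fun q => ‖boundaryPoint q τ - z‖ :=
    ((continuous_iff_continuousAt.2 fun q =>
      (hasDerivAt_boundaryPoint_radius q τ).continuousAt).sub continuous_const).norm
  have hclosed : IsClosed {q | r ≤ ‖boundaryPoint q τ - z‖} :=
    isClosed_le continuous_const hcont
  rw [← closure_Ioo hpπ.ne] at hq
  exact closure_minimal hopen hclosed hq

theorem norm_boundaryPoint_sub_eq_of_subset (hp : 0 ≤ p) (hpπ : p < Real.pi)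
    (hsub : Metric.closedBall z r ⊆ Complex.exp '' Metric.closedBall 0 p)
    (hmem : boundaryPoint p t ∈ Metric.closedBall z r) : ‖boundaryPoint p t - z‖ = r :=
  le_antisymm (mem_closedBall_iff_norm.1 hmem)
    (le_norm_boundaryPoint_sub_of_subset hp hpπ hsub t (Set.left_mem_Icc.2 hpπ.le))

theorem isLocalMin_norm_boundaryPoint_sub_sq (hp : 0 ≤ p) (hpπ : p < Real.pi)
    (hsub : Metric.closedBall z r ⊆ Complex.exp '' Metric.closedBall 0 p)
    (hmem : boundaryPoint p t ∈ Metric.closedBall z r) :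
    IsLocalMin (fun τ => ‖boundaryPoint p τ - z‖ ^ 2) t := by
  refine Filter.Eventually.of_forall fun τ => ?_
  refine pow_le_pow_left₀ (norm_nonneg _) ?_ 2
  rw [norm_boundaryPoint_sub_eq_of_subset hp hpπ hsub hmem]
  exact le_norm_boundaryPoint_sub_of_subset hp hpπ hsub τ (Set.left_mem_Icc.2 hpπ.le)

theorem isLocalMinOn_norm_boundaryPoint_sub_sq (hp : 0 ≤ p) (hpπ : p < Real.pi)
    (hsub : Metric.closedBall z r ⊆ Complex.exp '' Metric.closedBall 0 p)
    (hmem : boundaryPoint p t ∈ Metric.closedBall z r) :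
    IsLocalMinOn (fun q => ‖boundaryPoint q t - z‖ ^ 2) (Set.Ici p) p := by
  filter_upwards [Icc_mem_nhdsGE hpπ] with q hq
  refine pow_le_pow_left₀ (norm_nonneg _) ?_ 2
  rw [norm_boundaryPoint_sub_eq_of_subset hp hpπ hsub hmem]
  exact le_norm_boundaryPoint_sub_of_subset hp hpπ hsub t hq

theorem center_eq_of_subset (hp : 0 < p) (hpπ : p < Real.pi)
    (hsub : Metric.closedBall z r ⊆ Complex.exp '' Metric.closedBall 0 p)
    (hmem : boundaryPoint p t ∈ Metric.closedBall z r) :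
    z = boundaryPoint p t - r • outerNormal p t := by
  have hE := Real.exp_pos (p * Real.cos t)
  have htangential := (isLocalMin_norm_boundaryPoint_sub_sq hp.le hpπ hsub hmem).hasDerivAt_eq_zero
    ((hasDerivAt_boundaryPoint_arg p t).sub_const z).norm_sq
  have hnormal := nonneg_of_hasDerivAt_of_isLocalMinOn_Ici
    ((hasDerivAt_boundaryPoint_radius p t).sub_const z).norm_sq
    (isLocalMinOn_norm_boundaryPoint_sub_sq hp.le hpπ hsub hmem)
  simp only [real_inner_smul_right, mul_eq_zero, two_ne_zero, hp.ne', hE.ne', false_or]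
    at htangential
  rw [real_inner_smul_right, mul_nonneg_iff_of_pos_left two_pos, mul_nonneg_iff_of_pos_left hE]
    at hnormal
  have hparallel : boundaryPoint p t - z = r • outerNormal p t := by
    rw [Complex.real_smul, ← norm_boundaryPoint_sub_eq_of_subset hp.le hpπ hsub hmem]
    refine eq_norm_mul_of_conj_mul_nonneg (norm_outerNormal p t) (Complex.nonneg_iff.2 ⟨?_, ?_⟩)
    · rwa [Complex.inner, mul_comm] at hnormal
    · rw [Complex.inner] at htangential
      simp only [map_sub, Complex.mul_re, Complex.I_re, zero_mul, Complex.I_im, one_mul, zero_sub,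
        Complex.sub_re, Complex.conj_re, neg_mul, Complex.mul_im, zero_add, Complex.sub_im,
        Complex.conj_im, sub_neg_eq_add] at htangential ⊢
      linarith
  rw [← hparallel, sub_sub_cancel]

theorem hasDerivAt_inner_boundaryPoint_sub (p t : ℝ) (z : ℂ) :
    HasDerivAt (fun τ => inner ℝ (boundaryPoint p τ - z) (Complex.I * outerNormal p τ))
      (p * Real.exp (p * Real.cos t) -
        (1 + p * Real.cos t) * inner ℝ (boundaryPoint p t - z) (outerNormal p t)) t := by
  refine (((hasDerivAt_boundaryPoint_arg p t).sub_const z).inner ℝ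
    ((hasDerivAt_outerNormal p t).const_mul Complex.I)).congr_deriv ?_
  have hI : Complex.I * (1 + p * Real.cos t) • (Complex.I * outerNormal p t) =
      -((1 + p * Real.cos t) • outerNormal p t) := by
    rw [mul_smul_comm, ← mul_assoc, Complex.I_mul_I, neg_one_mul, smul_neg]
  rw [hI, inner_neg_right, real_inner_smul_right, real_inner_smul_left, real_inner_self_eq_norm_sq,
    norm_mul, Complex.norm_I, norm_outerNormal]
  ring

/- The first factor of the derivative `2 p e ^ (p cos τ) ⟪boundaryPoint p τ - z, i n⟫` of the
squared distance is positive and the second vanishes at `t`, so the second derivative at `t` has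
the sign of the derivative of the second factor. -/
theorem curvature_le_of_subset (hp : 0 < p) (hpπ : p < Real.pi)
    (hsub : Metric.closedBall z r ⊆ Complex.exp '' Metric.closedBall 0 p)
    (hmem : boundaryPoint p t ∈ Metric.closedBall z r) :
    r * (1 + p * Real.cos t) ≤ p * Real.exp (p * Real.cos t) := by
  have hradial : boundaryPoint p t - z = r • outerNormal p t := by
    rw [center_eq_of_subset hp hpπ hsub hmem, sub_sub_cancel]
  have hzero : inner ℝ (boundaryPoint p t - z) (Complex.I * outerNormal p t) = 0 := by
    rw [hradial, real_inner_smul_left, Complex.inner]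
    simp only [Complex.mul_re, Complex.mul_im, Complex.conj_re, Complex.conj_im, Complex.I_re,
      Complex.I_im]
    ring
  have hfirst (τ : ℝ) : HasDerivAt (fun τ => ‖boundaryPoint p τ - z‖ ^ 2)
      (2 * (p * Real.exp (p * Real.cos τ)) *
        inner ℝ (boundaryPoint p τ - z) (Complex.I * outerNormal p τ)) τ := by
    refine ((hasDerivAt_boundaryPoint_arg p τ).sub_const z).norm_sq.congr_deriv ?_
    rw [real_inner_smul_right]
    ring
  have hspeed : HasDerivAt (fun τ => 2 * (p * Real.exp (p * Real.cos τ))) _ t :=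
    (((Real.hasDerivAt_cos t).const_mul p).exp.const_mul p).const_mul 2
  have hsecond := deriv_deriv_nonneg_of_isLocalMin
    (isLocalMin_norm_boundaryPoint_sub_sq hp.le hpπ hsub hmem) (hfirst t).continuousAt
  rw [funext fun τ => (hfirst τ).deriv,
    (hspeed.fun_mul (hasDerivAt_inner_boundaryPoint_sub p t z)).deriv, hzero, mul_zero, zero_add,
    hradial, real_inner_smul_left, real_inner_self_eq_norm_sq, norm_outerNormal,
    mul_nonneg_iff_of_pos_left (by positivity)] at hsecond
  linarith

theorem boundaryPoint_pi_sub_ne (hp : p ≠ 0) (ht : Real.cos t ≠ 0) :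
    boundaryPoint p (Real.pi - t) ≠ boundaryPoint p t := fun h => by
  have hnorm := congrArg norm h
  rw [norm_boundaryPoint, norm_boundaryPoint, Real.exp_eq_exp, Real.cos_pi_sub,
    mul_right_inj' hp, neg_eq_self] at hnorm
  exact ht hnorm

/- If `cos t ≠ 0`, the disk `normalDisk 0 p t` touches the boundary also at
`boundaryPoint p (π - t)`, which a larger disk with the same tangent would contain in its interior.
If `cos t = 0`, the two points coincide and the bound is the comparison of curvatures. -/
theorem radius_le_of_subset (hp : 0 < p) (hpπ : p < Real.pi)
    (hsub : Metric.closedBall z r ⊆ Complex.exp '' Metric.closedBall 0 p)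
    (hmem : boundaryPoint p t ∈ Metric.closedBall z r) : r ≤ normalRadius 0 p t := by
  by_cases hc : Real.cos t = 0
  · simpa [hc, normalRadius_zero_left, sinhQuot] using curvature_le_of_subset hp hpπ hsub hmem
  · by_contra! hlt
    have hother : boundaryPoint p (Real.pi - t) ∈ normalDisk 0 p t := by
      simpa only [normalDisk_zero_left_congr (Real.sin_pi_sub t), zero_add] using
        boundaryPoint_mem_normalDisk hp.le 0 (Real.pi - t)
    rw [normalDisk, normalCenter_eq, zero_add] at hother
    have hinside := mem_ball_sub_smul_of_mem_closedBall (norm_outerNormal p t) hlt hother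
      (boundaryPoint_pi_sub_ne hp.ne' hc)
    rw [← center_eq_of_subset hp hpπ hsub hmem, mem_ball_iff_norm] at hinside
    exact hinside.not_ge
      (le_norm_boundaryPoint_sub_of_subset hp.le hpπ hsub _ (Set.left_mem_Icc.2 hpπ.le))

end TangentDisk

section Parameters

variable {p₁ p₂ t p₁' p₂' t' : ℝ}

theorem add_le_add_of_normalDisk_eq (h₁ : 0 ≤ p₁) (h₂ : 0 ≤ p₂) (hπ : p₁ + p₂ < Real.pi)
    (h₁' : 0 ≤ p₁') (h₂' : 0 ≤ p₂') (hπ' : p₁' + p₂' < Real.pi)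
    (h : normalDisk p₁' p₂' t' = normalDisk p₁ p₂ t) : p₁' + p₂' ≤ p₁ + p₂ :=
  le_of_boundaryPoint_mem_image (add_nonneg h₁' h₂') hπ' hπ <|
    normalDisk_subset_image_exp h₁ h₂ t (h ▸ boundaryPoint_mem_normalDisk h₂' p₁' t')

theorem normalRadius_congr (hsin : Real.sin t' = Real.sin t) (h₁ : 0 ≤ p₁)
    (hcos : 0 < p₁ → Real.cos t' = Real.cos t) (p₂ : ℝ) :
    normalRadius p₁ p₂ t' = normalRadius p₁ p₂ t := by
  rcases h₁.eq_or_lt with rfl | hpos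
  · exact normalRadius_zero_left_congr hsin p₂
  · rw [normalRadius, normalRadius, hcos hpos]

theorem normalParameters_unique (h₁ : 0 ≤ p₁) (h₂ : 0 ≤ p₂) (h0 : 0 < p₁ + p₂)
    (hπ : p₁ + p₂ < Real.pi) (h₁' : 0 ≤ p₁') (h₂' : 0 ≤ p₂') (hπ' : p₁' + p₂' < Real.pi)
    (hc : normalCenter p₁' p₂' t' = normalCenter p₁ p₂ t)
    (hr : normalRadius p₁' p₂' t' = normalRadius p₁ p₂ t) :
    p₁' = p₁ ∧ p₂' = p₂ ∧ Real.sin t' = Real.sin t ∧ (0 < p₁ → Real.cos t' = Real.cos t) := by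
  have hdisk : normalDisk p₁' p₂' t' = normalDisk p₁ p₂ t := by
    rw [normalDisk, normalDisk, hc, hr]
  have hsum : p₁' + p₂' = p₁ + p₂ := le_antisymm
    (add_le_add_of_normalDisk_eq h₁ h₂ hπ h₁' h₂' hπ' hdisk)
    (add_le_add_of_normalDisk_eq h₁' h₂' hπ' h₁ h₂ hπ hdisk.symm)
  have htouch := boundaryPoint_mem_normalDisk h₂' p₁' t'
  rw [hdisk, hsum] at htouch
  obtain ⟨hsin, hcos⟩ := sin_eq_and_cos_eq_of_boundaryPoint_mem_normalDisk h₁ h₂ h0 hπ htouch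
  have hp₂ : p₂' = p₂ := (strictMono_normalRadius (p₁ + p₂) t').injective <| by
    simp only [← hsum, add_sub_cancel_right, hr]
    rw [hsum, add_sub_cancel_right, normalRadius_congr hsin h₁ hcos]
  exact ⟨by linarith, hp₂, hsin, hcos⟩

theorem normalCenter_zero_zero (t : ℝ) : normalCenter 0 0 t = 1 := by
  simp [normalCenter, sinhQuot_zero_left]

theorem image_exp_closedBall_zero : Complex.exp '' Metric.closedBall 0 0 = {1} := by
  rw [Metric.closedBall_zero, Set.image_singleton, Complex.exp_zero]

theorem exists_normalParameters {p r : ℝ} {z : ℂ} (hp : 0 ≤ p) (hpπ : p < Real.pi)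
    (hsub : Metric.closedBall z r ⊆ Complex.exp '' Metric.closedBall 0 p)
    (hmem : boundaryPoint p t ∈ Metric.closedBall z r) :
    ∃ p₁ p₂, 0 ≤ p₁ ∧ 0 ≤ p₂ ∧ p = p₁ + p₂ ∧ z = normalCenter p₁ p₂ t ∧
      r = normalRadius p₁ p₂ t := by
  have hr : 0 ≤ r := Metric.nonempty_closedBall.1 ⟨_, hmem⟩
  rcases hp.eq_or_lt with rfl | hp
  · rw [image_exp_closedBall_zero] at hsub
    refine ⟨0, 0, le_rfl, le_rfl, (add_zero 0).symm, ?_, ?_⟩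
    · rw [normalCenter_zero_zero]
      exact hsub (Metric.mem_closedBall_self hr)
    · rw [normalRadius_zero_right]
      rw [← Metric.closedBall_zero] at hsub
      exact (le_of_closedBall_subset_closedBall hr hsub).antisymm hr
  have hle := radius_le_of_subset hp hpπ hsub hmem
  rw [← sub_self p] at hle
  obtain ⟨q, hq, hqr⟩ := exists_normalRadius_eq hp.le hr hle
  refine ⟨p - q, q, sub_nonneg.2 hq.2, hq.1, (sub_add_cancel p q).symm, ?_, hqr.symm⟩
  rw [normalCenter_eq, hqr, sub_add_cancel]
  exact center_eq_of_subset hp hpπ hsub hmem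

theorem closedBall_subset_normalDisk {r : ℝ} {z : ℂ} (h0 : 0 < p₂) (hπ : p₂ < Real.pi)
    (hsub : Metric.closedBall z r ⊆ Complex.exp '' Metric.closedBall 0 p₂)
    (hmem : boundaryPoint p₂ t ∈ Metric.closedBall z r) :
    Metric.closedBall z r ⊆ normalDisk 0 p₂ t := by
  rw [center_eq_of_subset h0 hπ hsub hmem, normalDisk, normalCenter_eq, zero_add]
  exact closedBall_sub_smul_subset (norm_outerNormal _ _).le _
    (radius_le_of_subset h0 hπ hsub hmem)

theorem isMaximalDisk_normalDisk_iff (h₁ : 0 ≤ p₁) (h₂ : 0 ≤ p₂) (h0 : 0 < p₁ + p₂)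
    (hπ : p₁ + p₂ < Real.pi) (t : ℝ) :
    IsMaximalDisk (Complex.exp '' Metric.closedBall 0 (p₁ + p₂)) (normalDisk p₁ p₂ t) ↔
      p₁ = 0 := by
  have hsub := normalDisk_subset_image_exp h₁ h₂ t
  have hsub₀ : normalDisk 0 (p₁ + p₂) t ⊆ Complex.exp '' Metric.closedBall 0 (p₁ + p₂) := by
    simpa only [zero_add] using normalDisk_subset_image_exp le_rfl h0.le t
  constructor
  · intro hmax
    have hle : normalDisk 0 (p₁ + p₂) t ⊆ normalDisk p₁ p₂ t :=
      hmax.2 ⟨⟨_, _, normalRadius_nonneg h0.le 0 t, rfl⟩, hsub₀⟩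
        (closedBall_subset_normalDisk h0 hπ hsub (boundaryPoint_mem_normalDisk h₂ p₁ t))
    have hrle := le_of_closedBall_subset_closedBall (normalRadius_nonneg h0.le 0 t) hle
    have hple : p₁ + p₂ ≤ p₂ := (strictMono_normalRadius (p₁ + p₂) t).le_iff_le.1 <| by
      simpa only [sub_self, add_sub_cancel_right] using hrle
    linarith
  · rintro rfl
    refine ⟨⟨⟨_, _, normalRadius_nonneg h₂ 0 t, rfl⟩, hsub⟩, ?_⟩
    rintro _ ⟨⟨z, r, -, rfl⟩, hzsub⟩ hle
    rw [zero_add] at h0 hπ hzsub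
    exact closedBall_subset_normalDisk h0 hπ hzsub <| hle <| by
      simpa only [zero_add] using boundaryPoint_mem_normalDisk h₂ 0 t

end Parameters

theorem exists_subset_image_closedBall_of_isOpenMap {X Y : Type*} [PseudoMetricSpace X]
    [TopologicalSpace Y] {f : X → Y} (hf : IsOpenMap f) {S : Set Y} (hS : IsCompact S)
    {c : X} {R : ℝ} (hsub : S ⊆ f '' Metric.ball c R) :
    ∃ q < R, S ⊆ f '' Metric.closedBall c q := by
  obtain ⟨⟨q, hq⟩, hsubq⟩ := hS.elim_directed_cover (fun q : Set.Iio R => f '' Metric.ball c q)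
    (fun _ => hf _ Metric.isOpen_ball)
    (fun z hz => by
      obtain ⟨w, hw, rfl⟩ := hsub hz
      obtain ⟨q, hwq, hqR⟩ := exists_between (Metric.mem_ball.1 hw)
      exact Set.mem_iUnion.2 ⟨⟨q, hqR⟩, w, hwq, rfl⟩)
    (directed_of_isDirected_le fun _ _ h => Set.image_mono (Metric.ball_subset_ball h))
  exact ⟨q, hq, hsubq.trans (Set.image_mono Metric.ball_subset_closedBall)⟩

theorem exists_int_of_cos_eq_of_sin_eq {t t' : ℝ} (hcos : Real.cos t' = Real.cos t)
    (hsin : Real.sin t' = Real.sin t) : ∃ k : ℤ, t' = t + 2 * Real.pi * k := by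
  obtain ⟨k, hk⟩ := Real.Angle.angle_eq_iff_two_pi_dvd_sub.1 (Real.Angle.cos_sin_inj hcos hsin)
  exact ⟨k, eq_add_of_sub_eq' hk⟩

theorem exists_int_of_sin_eq {t t' : ℝ} (h : Real.sin t' = Real.sin t) :
    ∃ k : ℤ, t' = t + 2 * Real.pi * k ∨ t' = Real.pi - t + 2 * Real.pi * k := by
  rcases cos_eq_or_eq_neg_of_sin_eq h with hcos | hcos
  · obtain ⟨k, hk⟩ := exists_int_of_cos_eq_of_sin_eq hcos h
    exact ⟨k, .inl hk⟩
  · obtain ⟨k, hk⟩ := exists_int_of_cos_eq_of_sin_eq (hcos.trans (Real.cos_pi_sub t).symm)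
      (h.trans (Real.sin_pi_sub t).symm)
    exact ⟨k, .inr hk⟩

section Classification

variable {A F : Matrix (Fin 2) (Fin 2) ℝ} {p₁ p₂ t : ℝ}

theorem exists_normalForm {p : ℝ} (hp : 0 ≤ p) (hpπ : p < Real.pi)
    (hsub : chiralDisk A ⊆ Complex.exp '' Metric.closedBall 0 p)
    (hmem : boundaryPoint p t ∈ chiralDisk A) :
    ∃ p₁ p₂ F, 0 ≤ p₁ ∧ 0 ≤ p₂ ∧ p = p₁ + p₂ ∧ F ∈ conjK ∧ A = normalForm p₁ p₂ t F := by
  obtain ⟨z, w, rfl⟩ := exists_eq_chiralMatrix A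
  rw [chiralDisk_chiralMatrix] at hsub hmem
  obtain ⟨p₁, p₂, h₁, h₂, hadd, hz, hr⟩ := exists_normalParameters hp hpπ hsub hmem
  have hu := Complex.norm_exp_ofReal_mul_I w.arg
  refine ⟨p₁, p₂, _, h₁, h₂, hadd, mem_conjK_iff.2 ⟨_, hu, rfl⟩, ?_⟩
  rw [normalForm_chiralMatrix, ← hz, ← hr, Complex.norm_mul_exp_arg_mul_I]

theorem chiralDisk_one : chiralDisk 1 = {1} := by
  rw [← chiralMatrix_one_zero, chiralDisk_chiralMatrix, norm_zero, Metric.closedBall_zero]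

theorem normalForm_eq_one_iff (hF : F ∈ conjK) (h₁ : 0 ≤ p₁) (h₂ : 0 ≤ p₂)
    (hπ : p₁ + p₂ < Real.pi) : normalForm p₁ p₂ t F = 1 ↔ p₁ = 0 ∧ p₂ = 0 := by
  constructor
  · intro h
    have hmem := boundaryPoint_mem_normalDisk h₂ p₁ t
    rw [← chiralDisk_normalForm hF h₂, h, chiralDisk_one, ← image_exp_closedBall_zero] at hmem
    have hle := le_of_boundaryPoint_mem_image (add_nonneg h₁ h₂) hπ Real.pi_pos hmem
    exact (add_eq_zero_iff_of_nonneg h₁ h₂).1 (hle.antisymm (add_nonneg h₁ h₂))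
  · rintro ⟨rfl, rfl⟩
    obtain ⟨u, -, rfl⟩ := mem_conjK_iff.1 hF
    rw [normalForm_chiralMatrix, normalCenter_zero_zero, normalRadius_zero_right,
      Complex.ofReal_zero, zero_mul, chiralMatrix_one_zero]

theorem exists_normalDisk_eq_singleton_iff (h₂ : 0 ≤ p₂) :
    (∃ z, normalDisk p₁ p₂ t = {z}) ↔ p₂ = 0 := by
  constructor
  · rintro ⟨z, hz⟩
    rw [normalDisk, ← Metric.closedBall_zero] at hz
    have hle := le_of_closedBall_subset_closedBall (normalRadius_nonneg h₂ p₁ t) hz.subset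
    by_contra hne
    exact (normalRadius_pos (h₂.lt_of_ne' hne) p₁ t).not_ge hle
  · rintro rfl
    exact ⟨_, by rw [normalDisk, normalRadius_zero_right, Metric.closedBall_zero]⟩

theorem normalForm_ne_one_and_singleton_iff (hF : F ∈ conjK) (h₁ : 0 ≤ p₁) (h₂ : 0 ≤ p₂)
    (hπ : p₁ + p₂ < Real.pi) :
    (normalForm p₁ p₂ t F ≠ 1 ∧ ∃ z, chiralDisk (normalForm p₁ p₂ t F) = {z}) ↔
      0 < p₁ ∧ p₂ = 0 := by
  rw [ne_eq, normalForm_eq_one_iff hF h₁ h₂ hπ, chiralDisk_normalForm hF h₂,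
    exists_normalDisk_eq_singleton_iff h₂, h₁.lt_iff_ne']
  tauto

theorem normalForm_ne_one_and_isMaximalDisk_iff (hF : F ∈ conjK) (h₁ : 0 ≤ p₁) (h₂ : 0 ≤ p₂)
    (hπ : p₁ + p₂ < Real.pi) :
    (normalForm p₁ p₂ t F ≠ 1 ∧ IsMaximalDisk (Complex.exp '' Metric.closedBall 0 (p₁ + p₂))
      (chiralDisk (normalForm p₁ p₂ t F))) ↔ p₁ = 0 ∧ 0 < p₂ := by
  rw [ne_eq, normalForm_eq_one_iff hF h₁ h₂ hπ, chiralDisk_normalForm hF h₂, h₂.lt_iff_ne']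
  by_cases h : p₁ = 0 ∧ p₂ = 0
  · tauto
  · have hpos : 0 < p₁ + p₂ := (add_nonneg h₁ h₂).lt_of_ne' fun h0 =>
      h ((add_eq_zero_iff_of_nonneg h₁ h₂).1 h0)
    rw [isMaximalDisk_normalDisk_iff h₁ h₂ hpos hπ]
    tauto

theorem normalForm_zero_right_congr (p t : ℝ) (F F' : Matrix (Fin 2) (Fin 2) ℝ) :
    normalForm p 0 t F = normalForm p 0 t F' := by
  rw [normalForm, normalForm, sinhQuot_zero_left, zero_smul, zero_smul]

theorem eq_of_normalForm_eq {p₁' p₂' t' : ℝ} {F' : Matrix (Fin 2) (Fin 2) ℝ} (hF : F ∈ conjK)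
    (h₁ : 0 ≤ p₁) (h₂ : 0 < p₂) (hπ : p₁ + p₂ < Real.pi) (hF' : F' ∈ conjK) (h₁' : 0 ≤ p₁')
    (h₂' : 0 ≤ p₂') (hπ' : p₁' + p₂' < Real.pi)
    (h : normalForm p₁ p₂ t F = normalForm p₁' p₂' t' F') :
    p₁' = p₁ ∧ p₂' = p₂ ∧ F' = F ∧ Real.sin t' = Real.sin t ∧
      (0 < p₁ → Real.cos t' = Real.cos t) := by
  obtain ⟨u, hu, rfl⟩ := mem_conjK_iff.1 hF
  obtain ⟨u', hu', rfl⟩ := mem_conjK_iff.1 hF'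
  rw [normalForm_chiralMatrix, normalForm_chiralMatrix, chiralMatrix_inj] at h
  obtain ⟨hcenter, hvector⟩ := h
  have hradius : normalRadius p₁' p₂' t' = normalRadius p₁ p₂ t := by
    simpa only [norm_mul, hu, hu', mul_one, Complex.norm_of_nonneg (normalRadius_nonneg h₂.le p₁ t),
      Complex.norm_of_nonneg (normalRadius_nonneg h₂' p₁' t')] using congrArg norm hvector.symm
  obtain ⟨e₁, e₂, hsin, hcos⟩ := normalParameters_unique h₁ h₂.le (by linarith) hπ h₁' h₂' hπ'
    hcenter.symm hradius
  rw [hradius] at hvector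
  have hne : (normalRadius p₁ p₂ t : ℂ) ≠ 0 :=
    Complex.ofReal_ne_zero.2 (normalRadius_pos h₂ p₁ t).ne'
  exact ⟨e₁, e₂, congrArg (chiralMatrix 0) (mul_left_cancel₀ hne hvector).symm, hsin, hcos⟩

end Classification

theorem mainTheorem9 (A : Matrix (Fin 2) (Fin 2) ℝ)
    (hA : chiralDisk A ⊆ Complex.exp '' Metric.ball (0 : ℂ) Real.pi)
    (p : ℝ)
    (hp : IsLeast {q : ℝ | chiralDisk A ⊆ Complex.exp '' Metric.closedBall (0 : ℂ) q} p)
    (t : ℝ)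
    (ht : Complex.exp ((p : ℂ) * ((Real.cos t : ℂ) + Complex.I * (Real.sin t : ℂ)))
      ∈ chiralDisk A) :
    -- existence of the normal form, with its realizations as time-ordered exponentials
    (∃ (p₁ p₂ : ℝ) (F : Matrix (Fin 2) (Fin 2) ℝ),
      0 ≤ p₁ ∧ 0 ≤ p₂ ∧ p = p₁ + p₂ ∧ F ∈ conjK ∧
      A = normalForm p₁ p₂ t F ∧
      A = leftExp
        (fun θ => p₁ • expI t + p₂ • (expI (2 * p * θ * Real.sin t) * F)) (-1 / 2) (1 / 2) ∧
      A = leftExp (fun _ => expI t) 0 p₁ *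
          leftExp (fun θ => expI ((2 * θ - p₁ - p₂) * Real.sin t) * F) 0 p₂ ∧
      A = leftExp (fun θ => expI ((2 * θ + p₁ - p₂) * Real.sin t) * F) 0 p₂ *
          leftExp (fun _ => expI t) 0 p₁) ∧
    -- the cases, for an arbitrary normal form of `A` belonging to `p` and `t`
    (∀ (p₁ p₂ : ℝ) (F : Matrix (Fin 2) (Fin 2) ℝ),
      0 ≤ p₁ → 0 ≤ p₂ → p = p₁ + p₂ → F ∈ conjK → A = normalForm p₁ p₂ t F →
      -- the identity matrix
      ((p₁ = 0 ∧ p₂ = 0) ↔ A = 1) ∧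
      -- the point disk case
      ((0 < p₁ ∧ p₂ = 0) ↔ (A ≠ 1 ∧ ∃ z : ℂ, chiralDisk A = {z})) ∧
      (0 < p₁ → p₂ = 0 → ∀ F' ∈ conjK, A = normalForm p₁ p₂ t F') ∧
      -- the maximal disk case
      ((p₁ = 0 ∧ 0 < p₂) ↔
        (A ≠ 1 ∧ IsMaximalDisk (Complex.exp '' Metric.closedBall (0 : ℂ) p) (chiralDisk A))) ∧
      (p₁ = 0 → 0 < p₂ →
        A = normalForm p₁ p₂ (Real.pi - t) F ∧
        ∀ (p₁' p₂' t' : ℝ) (F' : Matrix (Fin 2) (Fin 2) ℝ),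
          0 ≤ p₁' → 0 ≤ p₂' → p₁' + p₂' < Real.pi → F' ∈ conjK → A = normalForm p₁' p₂' t' F' →
          p₁' = p₁ ∧ p₂' = p₂ ∧ F' = F ∧
          ∃ k : ℤ, t' = t + 2 * Real.pi * k ∨ t' = Real.pi - t + 2 * Real.pi * k) ∧
      -- the general case: uniqueness
      (0 < p₁ → 0 < p₂ →
        ∀ (p₁' p₂' t' : ℝ) (F' : Matrix (Fin 2) (Fin 2) ℝ),
          0 ≤ p₁' → 0 ≤ p₂' → p₁' + p₂' < Real.pi → F' ∈ conjK → A = normalForm p₁' p₂' t' F' →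
          p₁' = p₁ ∧ p₂' = p₂ ∧ F' = F ∧ ∃ k : ℤ, t' = t + 2 * Real.pi * k)) := by
  obtain ⟨q, hqπ, hq⟩ := exists_subset_image_closedBall_of_isOpenMap Complex.isOpenMap_exp
    (isCompact_closedBall _ _) hA
  have hpπ : p < Real.pi := (hp.2 hq).trans_lt hqπ
  obtain ⟨v, hv, -⟩ := hp.1 ht
  have hp₀ : 0 ≤ p := dist_nonneg.trans hv
  constructor
  · obtain ⟨p₁, p₂, F, h₁, h₂, rfl, hF, rfl⟩ := exists_normalForm hp₀ hpπ hp.1 ht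
    exact ⟨p₁, p₂, F, h₁, h₂, rfl, hF, rfl, normalForm_eq_leftExp hF p₁ p₂ t,
      normalForm_eq_leftExp_mul_leftExp hF h₁ h₂ t, normalForm_eq_leftExp_mul_leftExp' hF h₁ h₂ t⟩
  · rintro p₁ p₂ F h₁ h₂ rfl hF rfl
    refine ⟨(normalForm_eq_one_iff hF h₁ h₂ hpπ).symm,
      (normalForm_ne_one_and_singleton_iff hF h₁ h₂ hpπ).symm, ?_,
      (normalForm_ne_one_and_isMaximalDisk_iff hF h₁ h₂ hpπ).symm, ?_, ?_⟩
    · rintro - rfl F' -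
      exact normalForm_zero_right_congr p₁ t F F'
    · rintro rfl hpos
      refine ⟨(normalForm_zero_left_congr (Real.sin_pi_sub t) p₂ F).symm, ?_⟩
      intro p₁' p₂' t' F' h₁' h₂' hπ' hF' h
      obtain ⟨e₁, e₂, e₃, hsin, -⟩ := eq_of_normalForm_eq hF h₁ hpos hpπ hF' h₁' h₂' hπ' h
      exact ⟨e₁, e₂, e₃, exists_int_of_sin_eq hsin⟩
    · intro hpos₁ hpos p₁' p₂' t' F' h₁' h₂' hπ' hF' h
      obtain ⟨e₁, e₂, e₃, hsin, hcos⟩ := eq_of_normalForm_eq hF h₁ hpos hpπ hF' h₁' h₂' hπ' h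
      exact ⟨e₁, e₂, e₃, exists_int_of_cos_eq_of_sin_eq (hcos hpos₁) hsin⟩
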